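/- Let $\mathrm{Ai}$ be the classical Airy function, $$\mathrm{Ai}(x)=\frac1{2\pi i}\int_C e^{-s^3/3+xs}\,ds,$$ where $C$ goes from $\infty e^{-2\pi i/3}$ to $\infty e^{2\pi i/3}$. The function $\delta\mapsto\mathrm{Ai}(-\delta)$ on $\mathbb R$ has a smallest zero $\delta_0$, and $\delta_0\approx 2.338$ (more precisely $|\delta_0-2.338|<0.0005$). Let $\Gamma$ be any contour in the complex plane that goes from infinity in the direction $e^{5\pi i/6}$ to infinity in the direction $e^{\pi i/6}$. For $\delta\in\mathbb R$ and $k\ge 0$ let $$\mu_k=\mu_k(\delta)=\int_\Gamma z^k e^{i(z^3/3-\delta z)}\,dz ,$$ and let $h_n=h_n(\delta)=\det(\mu_{j+k})_{0\le j,k\le n-1}$ be the Hankel determinants (with $h_0=1$). Then for every integer $n\ge 0$ and every real $\delta<\delta_0$ the moments converge and $h_n\neq 0$. Consequently, for every such $n$ and $\delta$ there is exactly one monic polynomial $p$ of degree $n$ with $$\int_\Gamma p(z)\,z^k e^{i(z^3/3-\delta z)}\,dz=0,\qquad k=0,\dots,n-1 ;$$ in particular this holds on an open interval of $\delta$ that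 contains the coalescence point $\delta=0$. -/

import Mathlib

open Filter Topology MeasureTheory

noncomputable section

namespace AiryOP

/-- `γ : ℝ → ℂ` parametrizes a contour that starts at infinity in the direction `exp (iα)` and
ends at infinity in the direction `exp (iβ)`. The regularity required of `γ` (continuous,
differentiable off a countable set, locally integrable derivative) is satisfied by every
piecewise continuously differentiable path. -/
structure IsContour (α β : ℝ) (γ : ℝ → ℂ) : Prop where
  continuous : Continuous γ
  differentiable : ∃ S : Set ℝ, S.Countable ∧ ∀ t ∉ S, DifferentiableAt ℝ γ t
  deriv_integrable : ∀ a b : ℝ, IntervalIntegrable (deriv γ) volume a b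
  norm_atBot : Tendsto (fun t => ‖γ t‖) atBot atTop
  norm_atTop : Tendsto (fun t => ‖γ t‖) atTop atTop
  direction_atBot : Tendsto (fun t => γ t / (‖γ t‖ : ℂ)) atBot (𝓝 (Complex.exp (α * Complex.I)))
  direction_atTop : Tendsto (fun t => γ t / (‖γ t‖ : ℂ)) atTop (𝓝 (Complex.exp (β * Complex.I)))

/-- The integral of `f` over the part of the contour with parameters between `a` and `b`. -/
def partialIntegral (γ : ℝ → ℂ) (f : ℂ → ℂ) (a b : ℝ) : ℂ :=
  ∫ t in a..b, f (γ t) * deriv γ t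

/-- The integral of `f` along the infinite contour `γ` converges, with value `v`. -/
def HasContourIntegral (γ : ℝ → ℂ) (f : ℂ → ℂ) (v : ℂ) : Prop :=
  Tendsto (fun p : ℝ × ℝ => partialIntegral γ f p.1 p.2) (atBot ×ˢ atTop) (𝓝 v)

/-- The value of the integral of `f` along the infinite contour `γ` (when it converges). -/
def contourIntegral (γ : ℝ → ℂ) (f : ℂ → ℂ) : ℂ :=
  limUnder (atBot ×ˢ atTop) (fun p : ℝ × ℝ => partialIntegral γ f p.1 p.2)

/-- The contour made of the ray from infinity in the direction `exp (iα)` to `0` and the ray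
from `0` to infinity in the direction `exp (iβ)`. -/
def rays (α β : ℝ) (t : ℝ) : ℂ :=
  if t ≤ 0 then ((-t : ℝ) : ℂ) * Complex.exp (α * Complex.I)
  else (t : ℂ) * Complex.exp (β * Complex.I)

/-- The classical Airy function
`Ai x = (2πi)⁻¹ ∫_C exp (-s³/3 + x s) ds`, where `C` goes from `∞ exp (-2πi/3)` to
`∞ exp (2πi/3)`. -/
def Ai (x : ℂ) : ℂ :=
  (2 * Real.pi * Complex.I)⁻¹ *
    contourIntegral (rays (-(2 * Real.pi / 3)) (2 * Real.pi / 3))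
      (fun s => Complex.exp (-(s ^ 3 / 3) + x * s))

/-- The weight function `exp (i (z³/3 - δ z))`. -/
def weight (δ : ℝ) (z : ℂ) : ℂ :=
  Complex.exp (Complex.I * (z ^ 3 / 3 - δ * z))

/-- The moment `μ_k = ∫_Γ z ^ k exp (i (z³/3 - δ z)) dz`. -/
def moment (γ : ℝ → ℂ) (δ : ℝ) (k : ℕ) : ℂ :=
  contourIntegral γ (fun z => z ^ k * weight δ z)

/-- The `n × n` Hankel matrix of the moments. -/
def hankel (γ : ℝ → ℂ) (δ : ℝ) (n : ℕ) : Matrix (Fin n) (Fin n) ℂ :=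
  Matrix.of fun j k => moment γ δ ((j : ℕ) + (k : ℕ))

/-- `p` is a monic orthogonal polynomial of degree `n` for the weight `exp (i (z³/3 - δ z))`
on the contour `γ`. -/
structure IsMonicOrthogonal (γ : ℝ → ℂ) (δ : ℝ) (n : ℕ) (p : Polynomial ℂ) : Prop where
  monic : p.Monic
  natDegree_eq : p.natDegree = n
  orthogonal : ∀ k < n, HasContourIntegral γ (fun z => p.eval z * z ^ k * weight δ z) 0

end AiryOP

end

/-!
# Hankel determinants of the cubic exponential weight and the Airy function

Rotating the contour turns the moments into derivatives of the Airy function: with `x = -δ`, the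
`k`-th moment is `2 π (-i) ^ k Ai⁽ᵏ⁾(x)`. Hence the Hankel determinants are, up to nonzero factors,
the determinants of the real Hankel matrices of `Ai⁽ʲ⁺ᵏ⁾(x)` (`hasContourIntegral_moment`,
`det_hankel_ne_zero`).

The functional `L` on polynomials with moments `Ai⁽ᵏ⁾(x)` satisfies `L (p') + x L p = L (X² p)`,
which is Airy's equation. It forces the recurrence coefficients `α n`, `b n` (in
`p (n + 1) = (X + α n) p n + b n p (n - 1)`) to satisfy `b n + b (n + 1) = (α n)² - x` and
`b n (α n + α (n - 1)) = n`. Conversely, the scalars defined by this recursion from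
`α 0 = -Ai'/Ai` produce orthogonal polynomials whose norms are `L (p n ²) = Ai ∏ (-b k)`
(`recPoly_orthogonal`), as long as no `b k` vanishes. So it is enough to show `b n > 0` for all
`n ≥ 1` to the right of the largest zero of `Ai` (`recB_succ_pos`).

As functions of `x` the coefficients satisfy the Toda equations `α n' = b (n + 1) - b n` and
`b n' = n - 2 α n b n`. For `n = 1`, `b 1 Ai² = Ai'² - x Ai²` has derivative `-Ai²` and tends to `0`
at `+∞`, so it is positive. For the step from `b n > 0`, the product `q = b n b (n + 1)` satisfies
`q' = n b (n + 1) - (n + 1) b n`; if `b (n + 1) ≤ 0` at some point, then `q` is decreasing from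
there on and stays below a negative constant, so `α n' = b (n + 1) - b n` is bounded above
by a negative constant. As also `α n' ≤ x - (α n)²`, the function `α n` would reach `-∞` in finite time
(`pos_of_airy_system`, `riccati_not_linear_decay`).

The largest zero of `Ai` is located by Wronskian comparison with truncated Maclaurin series, which
are sub- or supersolutions of Airy's equation: on `[0, 3]`, where `Ai > 0 ≥ Ai'`, this brackets
`-Ai'(0) / Ai(0)`, and on `[-2.3385, 0]` it then brackets the zero
(`exists_largest_airy_zero`).
-/

open Filter Topology MeasureTheory

noncomputable section

namespace AiryOP

/-! ### The Airy function as a real integral -/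

/-- The primitive cube root of unity `exp (2πi/3)`, in Cartesian form. -/
def cubeRoot : ℂ := ⟨-(1 / 2), √3 / 2⟩

lemma cubeRoot_sq : cubeRoot ^ 2 = ⟨-(1 / 2), -(√3 / 2)⟩ := by
  have h : √3 * √3 = 3 := Real.mul_self_sqrt (by norm_num)
  apply Complex.ext
  · simp [cubeRoot, pow_two]; nlinarith
  · simp [cubeRoot, pow_two]; ring

lemma cubeRoot_pow_three : cubeRoot ^ 3 = 1 := by
  have h : √3 * √3 = 3 := Real.mul_self_sqrt (by norm_num)
  rw [pow_succ, cubeRoot_sq]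
  apply Complex.ext
  · simp [cubeRoot]; nlinarith
  · simp [cubeRoot]; ring

lemma norm_cubeRoot : ‖cubeRoot‖ = 1 := by
  have h : ‖cubeRoot‖ ^ 3 = 1 := by rw [← norm_pow, cubeRoot_pow_three, norm_one]
  exact (pow_eq_one_iff_of_nonneg (norm_nonneg _) (by norm_num)).1 h

/-- The integrand `t ^ k exp (-t³/3 + x ω t)`, with `ω = exp (2πi/3)`. -/
def rayIntegrand (k : ℕ) (x t : ℝ) : ℂ :=
  (t : ℂ) ^ k * Complex.exp (-((t : ℂ) ^ 3 / 3) + x * cubeRoot * t)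

/-- The integral of `rayIntegrand k x` over the positive half-line. -/
def rayIntegral (k : ℕ) (x : ℝ) : ℂ := ∫ t in Set.Ioi (0 : ℝ), rayIntegrand k x t

/-- The real function `Im (ω ^ (k + 1) ∫₀^∞ t ^ k exp (-t³/3 + x ω t) dt) / π`, which is the
`k`-th derivative of the Airy function at the real point `x`. -/
def airyDeriv (k : ℕ) (x : ℝ) : ℝ := (cubeRoot ^ (k + 1) * rayIntegral k x).im / Real.pi

/-- The bound `t ^ k exp (-t³/3 + c t)` for the integrands. -/
def cubicBound (k : ℕ) (c t : ℝ) : ℝ := t ^ k * Real.exp (-(t ^ 3 / 3) + c * t)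

lemma continuous_cubicBound (k : ℕ) (c : ℝ) : Continuous (cubicBound k c) := by
  unfold cubicBound; fun_prop

lemma cubicBound_isBigO (k : ℕ) (c : ℝ) :
    cubicBound k c =O[atTop] fun t => Real.exp (-1 * t) := by
  refine Asymptotics.IsBigO.of_bound (k.factorial : ℝ) ?_
  filter_upwards [eventually_ge_atTop (3 * (|c| + 2)), eventually_ge_atTop 1] with t ht ht1
  have h0 : 0 ≤ t := by linarith
  have h1 := Real.pow_div_factorial_le_exp t h0 k
  rw [div_le_iff₀ (by positivity)] at h1
  rw [cubicBound, Real.norm_of_nonneg (by positivity), Real.norm_of_nonneg (by positivity)]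
  calc t ^ k * Real.exp (-(t ^ 3 / 3) + c * t)
      ≤ (Real.exp t * k.factorial) * Real.exp (-2 * t) := by
        gcongr
        have : |c| * t ≥ c * t := by gcongr; exact le_abs_self c
        nlinarith [abs_nonneg c, mul_nonneg h0 h0, mul_nonneg (sub_nonneg.2 ht1) h0,
          mul_nonneg (sub_nonneg.2 ht) (mul_nonneg (sub_nonneg.2 ht1) h0),
          mul_nonneg (sub_nonneg.2 ht) h0]
    _ = k.factorial * Real.exp (-1 * t) := by
        rw [mul_comm (Real.exp t), mul_assoc, ← Real.exp_add]; ring_nf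

lemma integrableOn_cubicBound (k : ℕ) (c : ℝ) :
    IntegrableOn (cubicBound k c) (Set.Ioi 0) :=
  integrable_of_isBigO_exp_neg one_pos (continuous_cubicBound k c).continuousOn
    (cubicBound_isBigO k c)

lemma continuous_rayIntegrand (k : ℕ) (x : ℝ) : Continuous (rayIntegrand k x) := by
  unfold rayIntegrand; fun_prop

lemma norm_rayIntegrand (k : ℕ) (x : ℝ) {t : ℝ} (ht : 0 ≤ t) :
    ‖rayIntegrand k x t‖ = cubicBound k (-(x / 2)) t := by
  rw [rayIntegrand, cubicBound, norm_mul, norm_pow, Complex.norm_real, Real.norm_of_nonneg ht,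
    Complex.norm_exp]
  congr 2
  have h1 : ((t : ℂ) ^ 3 / 3) = ((t ^ 3 / 3 : ℝ) : ℂ) := by push_cast; rfl
  rw [h1, Complex.add_re, Complex.neg_re, Complex.ofReal_re]
  simp [cubeRoot]
  left
  ring

lemma integrableOn_rayIntegrand (k : ℕ) (x : ℝ) :
    IntegrableOn (rayIntegrand k x) (Set.Ioi 0) := by
  refine (integrableOn_cubicBound k (-(x / 2))).mono'
    (continuous_rayIntegrand k x).aestronglyMeasurable ?_
  filter_upwards [ae_restrict_mem measurableSet_Ioi] with t ht
  exact (norm_rayIntegrand k x (le_of_lt ht)).le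

lemma hasDerivAt_rayIntegral (k : ℕ) (x : ℝ) :
    HasDerivAt (rayIntegral k) (cubeRoot * rayIntegral (k + 1) x) x := by
  have hd := hasDerivAt_integral_of_dominated_loc_of_deriv_le
    (μ := volume.restrict (Set.Ioi (0 : ℝ))) (F := fun y t => rayIntegrand k y t)
    (F' := fun y t => cubeRoot * rayIntegrand (k + 1) y t) (x₀ := x)
    (s := Metric.ball x 1) (bound := cubicBound (k + 1) (|x| + 1))
    (Metric.ball_mem_nhds x one_pos)
    (Eventually.of_forall fun y => (continuous_rayIntegrand k y).aestronglyMeasurable)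
    (integrableOn_rayIntegrand k x)
    (((continuous_rayIntegrand (k + 1) x).const_smul cubeRoot).aestronglyMeasurable)
    ?_ (integrableOn_cubicBound _ _) ?_
  · have := hd.2
    rw [integral_const_mul] at this
    exact this
  · filter_upwards [ae_restrict_mem measurableSet_Ioi] with t ht y hy
    have ht0 : (0 : ℝ) ≤ t := le_of_lt ht
    rw [norm_mul, norm_cubeRoot, one_mul, norm_rayIntegrand _ _ ht0, cubicBound, cubicBound]
    gcongr
    rw [Metric.mem_ball, Real.dist_eq, abs_lt] at hy
    linarith [neg_abs_le x, abs_nonneg x]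
  · refine Eventually.of_forall fun t y _ => ?_
    have h1 : HasDerivAt (fun y : ℝ => (y : ℂ)) 1 y := Complex.ofRealCLM.hasDerivAt
    have h2 : HasDerivAt (fun y : ℝ => -((t : ℂ) ^ 3 / 3) + y * cubeRoot * t)
        (1 * cubeRoot * t) y := ((h1.mul_const cubeRoot).mul_const (t : ℂ)).const_add _
    have h3 := (h2.cexp).const_mul ((t : ℂ) ^ k)
    refine h3.congr_deriv ?_
    simp only [rayIntegrand]
    ring

lemma hasDerivAt_airyDeriv (k : ℕ) (x : ℝ) :
    HasDerivAt (airyDeriv k) (airyDeriv (k + 1) x) x := by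
  have h := ((hasDerivAt_rayIntegral k x).const_mul (cubeRoot ^ (k + 1)))
  have h2 := (Complex.imCLM.hasFDerivAt.comp_hasDerivAt x h).div_const Real.pi
  refine h2.congr_deriv ?_
  simp only [airyDeriv, Complex.imCLM_apply]
  ring_nf

/-- Airy's equation, from `∫₀^∞ (d/dt) exp (-t³/3 + x ω t) dt = -1`: the boundary term is real. -/
lemma airyDeriv_two (x : ℝ) : airyDeriv 2 x = x * airyDeriv 0 x := by
  have hder : ∀ t ∈ Set.Ici (0 : ℝ), HasDerivAt (rayIntegrand 0 x)
      (-rayIntegrand 2 x t + x * cubeRoot * rayIntegrand 0 x t) t := by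
    intro t _
    have h1 : HasDerivAt (fun y : ℝ => (y : ℂ)) 1 t := Complex.ofRealCLM.hasDerivAt
    have h2 : HasDerivAt (fun y : ℝ => -((y : ℂ) ^ 3 / 3) + x * cubeRoot * y)
        (-((3 : ℕ) * (t : ℂ) ^ 2 * 1 / 3) + x * cubeRoot * 1) t :=
      ((h1.pow 3).div_const 3).neg.add (h1.const_mul _)
    have h3 := (h2.cexp).const_mul ((1 : ℂ))
    refine (h3.congr_of_eventuallyEq (Eventually.of_forall fun y => ?_)).congr_deriv ?_
    · simp [rayIntegrand]
    · simp only [rayIntegrand]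
      push_cast
      ring
  have hlim : Tendsto (rayIntegrand 0 x) atTop (𝓝 0) := by
    have h0 : Tendsto (cubicBound 0 (-(x / 2))) atTop (𝓝 0) := by
      refine (cubicBound_isBigO 0 _).trans_tendsto ?_
      simpa using Real.tendsto_exp_neg_atTop_nhds_zero
    rw [tendsto_zero_iff_norm_tendsto_zero]
    refine h0.congr' ?_
    filter_upwards [eventually_ge_atTop 0] with t ht
    exact (norm_rayIntegrand 0 x ht).symm
  have hI := integral_Ioi_of_hasDerivAt_of_tendsto' hder
    ((integrableOn_rayIntegrand 2 x).neg.add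
      ((integrableOn_rayIntegrand 0 x).const_mul _)) hlim
  rw [integral_add (f := fun t => -rayIntegrand 2 x t) (integrableOn_rayIntegrand 2 x).neg
      ((integrableOn_rayIntegrand 0 x).const_mul _), integral_neg, integral_const_mul] at hI
  have hJ : rayIntegral 2 x = x * (cubeRoot * rayIntegral 0 x) + 1 := by
    have : rayIntegrand 0 x 0 = 1 := by simp [rayIntegrand]
    rw [this] at hI
    unfold rayIntegral
    linear_combination -hI
  rw [airyDeriv, airyDeriv, cubeRoot_pow_three, hJ]
  rw [zero_add, pow_one, one_mul, Complex.add_im, Complex.im_ofReal_mul,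
    Complex.one_im]
  ring

lemma airyDeriv_three_term (k : ℕ) (x : ℝ) :
    airyDeriv (k + 3) x = x * airyDeriv (k + 1) x + (k + 1) * airyDeriv k x := by
  induction k generalizing x with
  | zero =>
    have h1 := hasDerivAt_airyDeriv 2 x
    have h2 : HasDerivAt (airyDeriv 2) (1 * airyDeriv 0 x + x * airyDeriv 1 x) x := by
      rw [show airyDeriv 2 = fun y => y * airyDeriv 0 y from funext airyDeriv_two]
      exact (hasDerivAt_id x).mul (hasDerivAt_airyDeriv 0 x)
    have := h1.unique h2
    simp only [zero_add, Nat.cast_zero]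
    linarith
  | succ k ih =>
    have h1 := hasDerivAt_airyDeriv (k + 3) x
    have h2 : HasDerivAt (airyDeriv (k + 3)) ((1 * airyDeriv (k + 1) x
        + x * airyDeriv (k + 2) x) + (k + 1) * airyDeriv (k + 1) x) x := by
      rw [show airyDeriv (k + 3) = fun y => y * airyDeriv (k + 1) y + (k + 1) * airyDeriv k y
        from funext ih]
      exact ((hasDerivAt_id x).mul (hasDerivAt_airyDeriv (k + 1) x)).add
        ((hasDerivAt_airyDeriv k x).const_mul _)
    have := h1.unique h2
    push_cast
    linarith

lemma airyDeriv_zero_pos : 0 < airyDeriv 0 0 := by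
  have hval : rayIntegral 0 0 = ((∫ t in Set.Ioi (0 : ℝ), cubicBound 0 0 t : ℝ) : ℂ) := by
    rw [rayIntegral, ← integral_complex_ofReal]
    refine integral_congr_ae (Eventually.of_forall fun t => ?_)
    simp only [rayIntegrand, cubicBound]
    push_cast
    simp
  have hpos : 0 < ∫ t in Set.Ioi (0 : ℝ), cubicBound 0 0 t := by
    rw [setIntegral_pos_iff_support_of_nonneg_ae]
    · have : Function.support (cubicBound 0 0) = Set.univ := by
        ext t; simp [cubicBound, Real.exp_ne_zero]
      rw [this]; simp
    · refine Eventually.of_forall fun t => ?_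
      simp only [cubicBound, Pi.zero_apply]; positivity
    · exact integrableOn_cubicBound 0 0
  rw [airyDeriv, hval, zero_add, pow_one, Complex.im_mul_ofReal]
  simp only [cubeRoot]
  positivity

lemma integrableOn_pow_mul_exp_neg (k : ℕ) {r : ℝ} (hr : 0 < r) :
    IntegrableOn (fun t : ℝ => t ^ k * Real.exp (-(r * t))) (Set.Ioi 0) ∧
    ∫ t in Set.Ioi (0 : ℝ), t ^ k * Real.exp (-(r * t)) = k.factorial / r ^ (k + 1) := by
  have h := Real.integral_rpow_mul_exp_neg_mul_Ioi (a := k + 1) (by positivity) hr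
  rw [Real.Gamma_nat_eq_factorial] at h
  have h2 : ∫ t in Set.Ioi (0 : ℝ), t ^ k * Real.exp (-(r * t)) = k.factorial / r ^ (k + 1) := by
    rw [show ((k : ℝ) + 1) = ((k + 1 : ℕ) : ℝ) by push_cast; rfl, Real.rpow_natCast] at h
    rw [show (k.factorial : ℝ) / r ^ (k + 1) = (1 / r) ^ (k + 1) * k.factorial by
      rw [one_div, inv_pow]; ring, ← h]
    refine setIntegral_congr_fun measurableSet_Ioi fun t _ => ?_
    simp
  refine ⟨?_, h2⟩
  by_contra hn
  -- a non-integrable function would have integral zero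
  rw [integral_undef hn] at h2
  have : (0 : ℝ) < k.factorial / r ^ (k + 1) := by positivity
  linarith

lemma abs_airyDeriv_le (k : ℕ) {x : ℝ} (hx : 0 < x) :
    |airyDeriv k x| ≤ k.factorial / (x / 2) ^ (k + 1) := by
  obtain ⟨hint, hval⟩ := integrableOn_pow_mul_exp_neg k (half_pos hx)
  have h1 : ‖rayIntegral k x‖ ≤ k.factorial / (x / 2) ^ (k + 1) := by
    rw [← hval]
    refine norm_integral_le_of_norm_le hint ?_
    filter_upwards [ae_restrict_mem measurableSet_Ioi] with t ht
    have ht0 : (0 : ℝ) ≤ t := le_of_lt ht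
    rw [norm_rayIntegrand k x ht0, cubicBound]
    gcongr
    nlinarith [pow_nonneg ht0 3]
  have h2 : |(cubeRoot ^ (k + 1) * rayIntegral k x).im| ≤ ‖rayIntegral k x‖ := by
    refine (Complex.abs_im_le_norm _).trans ?_
    rw [norm_mul, norm_pow, norm_cubeRoot, one_pow, one_mul]
  rw [airyDeriv, abs_div, abs_of_pos Real.pi_pos]
  refine (div_le_self (abs_nonneg _) ?_).trans (h2.trans h1)
  linarith [Real.pi_gt_three]

lemma continuous_airyDeriv (k : ℕ) : Continuous (airyDeriv k) :=
  continuous_iff_continuousAt.2 fun x => (hasDerivAt_airyDeriv k x).continuousAt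

lemma tendsto_const_div_atTop (c : ℝ) : Tendsto (fun x : ℝ => c / x) atTop (𝓝 0) :=
  tendsto_const_nhds.div_atTop tendsto_id

lemma tendsto_airyDeriv_zero_mul_one :
    Tendsto (fun x => airyDeriv 0 x * airyDeriv 1 x) atTop (𝓝 0) := by
  refine squeeze_zero_norm' ?_ (tendsto_const_div_atTop 8)
  filter_upwards [eventually_ge_atTop 1] with x hx
  have h0 : |airyDeriv 0 x| ≤ 2 / x := by
    refine (abs_airyDeriv_le 0 (by linarith)).trans_eq ?_
    simp
  have h1 : |airyDeriv 1 x| ≤ 4 / x ^ 2 := by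
    refine (abs_airyDeriv_le 1 (by linarith)).trans_eq ?_
    simp; field_simp; norm_num
  rw [Real.norm_eq_abs, abs_mul]
  calc |airyDeriv 0 x| * |airyDeriv 1 x| ≤ (2 / x) * (4 / x ^ 2) := by gcongr
    _ = 8 / x ^ 3 := by field_simp; norm_num
    _ ≤ 8 / x := by gcongr; nlinarith [sq_nonneg x]

lemma tendsto_airy_energy :
    Tendsto (fun x => airyDeriv 1 x ^ 2 - x * airyDeriv 0 x ^ 2) atTop (𝓝 0) := by
  refine squeeze_zero_norm' ?_ (tendsto_const_div_atTop 20)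
  filter_upwards [eventually_ge_atTop 1] with x hx
  have h0 : |airyDeriv 0 x| ≤ 2 / x := by
    refine (abs_airyDeriv_le 0 (by linarith)).trans_eq ?_
    simp
  have h1 : |airyDeriv 1 x| ≤ 4 / x := by
    refine (abs_airyDeriv_le 1 (by linarith)).trans ?_
    have : (Nat.factorial 1 : ℝ) / (x / 2) ^ (1 + 1) = 4 / x ^ 2 := by
      simp; field_simp; norm_num
    rw [this]
    gcongr; nlinarith
  rw [Real.norm_eq_abs]
  refine (abs_sub _ _).trans ?_
  rw [abs_mul, abs_pow, abs_pow, abs_of_nonneg (by linarith : 0 ≤ x)]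
  calc |airyDeriv 1 x| ^ 2 + x * |airyDeriv 0 x| ^ 2 ≤ (4 / x) ^ 2 + x * (2 / x) ^ 2 := by gcongr
    _ = 16 / x ^ 2 + 4 / x := by field_simp; ring
    _ ≤ 16 / x + 4 / x := by gcongr; nlinarith
    _ = 20 / x := by ring

/-! ### Contour integrals of `z ^ k exp (i (z³/3 - δ z))` -/

lemma differentiable_pow_mul_weight (δ : ℝ) (k : ℕ) :
    Differentiable ℂ fun z => z ^ k * weight δ z := by
  unfold weight; fun_prop

lemma partialIntegral_eq_sub {α β : ℝ} {γ : ℝ → ℂ} (hγ : IsContour α β γ) {f F : ℂ → ℂ}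
    (hf : Continuous f) (hF : ∀ z, HasDerivAt F (f z) z) (a b : ℝ) :
    partialIntegral γ f a b = F (γ b) - F (γ a) := by
  obtain ⟨S, hS, hd⟩ := hγ.differentiable
  have hFc : Continuous F := continuous_iff_continuousAt.2 fun z => (hF z).continuousAt
  refine integral_eq_of_hasDerivAt_off_countable (fun t => F (γ t)) _ hS
    (hFc.comp hγ.continuous).continuousOn (fun t ht => ?_) ?_
  · exact (hF (γ t)).comp_of_eq t (hd t ht.2).hasDerivAt rfl |>.congr_deriv rfl
  · exact (hγ.deriv_integrable a b).continuousOn_mul (hf.comp hγ.continuous).continuousOn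

/-- In a small sector around a direction `e` with `i e³ = -1` the weight decays cubically. -/
lemma norm_weight_le_of_sector (δ : ℝ) {e v : ℂ} (he : Complex.I * e ^ 3 = -1) (he1 : ‖e‖ = 1)
    (hv : ‖v - e‖ ≤ 1 / 10) {r : ℝ} (hr : 0 ≤ r) :
    ‖weight δ (r * v)‖ ≤ Real.exp (-(r ^ 3 / 6) + 2 * |δ| * r) := by
  have hv2 : ‖v‖ ≤ 2 := by
    have := norm_add_le (v - e) e
    rw [sub_add_cancel] at this
    linarith
  have hcube : ‖v ^ 3 - e ^ 3‖ ≤ 1 / 2 := by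
    have h1 : v ^ 3 - e ^ 3
        = (v - e) * (3 * e ^ 2 + 3 * (e * (v - e)) + (v - e) ^ 2) := by ring
    have h2 : ‖3 * e ^ 2 + 3 * (e * (v - e)) + (v - e) ^ 2‖
        ≤ 3 + 3 * (1 / 10) + (1 / 10) ^ 2 := by
      refine (norm_add₃_le).trans ?_
      simp only [norm_mul, norm_pow, he1, RCLike.norm_ofNat]
      gcongr <;> linarith
    rw [h1, norm_mul]
    calc _ ≤ (1 / 10) * (3 + 3 * (1 / 10) + (1 / 10 : ℝ) ^ 2) := by gcongr
      _ ≤ 1 / 2 := by norm_num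
  rw [weight, Complex.norm_exp, Real.exp_le_exp]
  have hsplit : Complex.I * (((r : ℂ) * v) ^ 3 / 3 - δ * (r * v))
      = ((r ^ 3 / 3 : ℝ) : ℂ) * (-1 + Complex.I * (v ^ 3 - e ^ 3))
        + ((-(δ * r) : ℝ) : ℂ) * (Complex.I * v) := by
    push_cast
    linear_combination ((r : ℂ) ^ 3 / 3) * he
  rw [hsplit, Complex.add_re, Complex.re_ofReal_mul, Complex.re_ofReal_mul, Complex.add_re,
    Complex.neg_re, Complex.one_re]
  have h1 : (Complex.I * (v ^ 3 - e ^ 3)).re ≤ 1 / 2 := by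
    refine (Complex.re_le_norm _).trans ?_
    rwa [norm_mul, Complex.norm_I, one_mul]
  have h2 : -(δ * r) * (Complex.I * v).re ≤ |δ| * r * 2 := by
    refine (le_abs_self _).trans ?_
    rw [abs_mul, abs_neg, abs_mul, abs_of_nonneg hr]
    gcongr
    refine (Complex.abs_re_le_norm _).trans ?_
    rwa [norm_mul, Complex.norm_I, one_mul]
  have h3 : r ^ 3 / 3 * (-1 + (Complex.I * (v ^ 3 - e ^ 3)).re) ≤ r ^ 3 / 3 * (-1 + 1 / 2) := by
    gcongr
  linarith

lemma tendsto_pow_mul_exp_neg_cube (k : ℕ) (c : ℝ) :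
    Tendsto (fun r : ℝ => r ^ k * Real.exp (-(r ^ 3 / 6) + c * r)) atTop (𝓝 0) := by
  have h0 : Tendsto (fun r : ℝ => r / 2) atTop atTop := tendsto_id.atTop_div_const (by norm_num)
  have h1 := ((cubicBound_isBigO k (2 * c)).trans_tendsto
    (by simpa using Real.tendsto_exp_neg_atTop_nhds_zero)).comp h0
  have h2 := h1.const_mul ((2 : ℝ) ^ k)
  rw [mul_zero] at h2
  refine squeeze_zero' ?_ ?_ h2
  · filter_upwards [eventually_ge_atTop 0] with r hr
    positivity
  · filter_upwards [eventually_ge_atTop 0] with r hr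
    simp only [Function.comp, cubicBound]
    rw [← mul_assoc, ← mul_pow, mul_div_cancel₀ _ (by norm_num : (2 : ℝ) ≠ 0)]
    refine mul_le_mul_of_nonneg_left (Real.exp_le_exp.2 ?_) (by positivity)
    nlinarith [pow_nonneg hr 3]

/-- The integral of `z ^ k exp (i (z³/3 - δ z))` along the ray from `0` to infinity in the
direction `e`. -/
def rayMoment (δ : ℝ) (k : ℕ) (e : ℂ) : ℂ :=
  ∫ t in Set.Ioi (0 : ℝ), ((t : ℂ) * e) ^ k * weight δ (t * e) * e

lemma norm_pow_mul_weight_le (δ : ℝ) (k : ℕ) {e v : ℂ} (he : Complex.I * e ^ 3 = -1)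
    (he1 : ‖e‖ = 1) (hv : ‖v - e‖ ≤ 1 / 10) {r : ℝ} (hr : 0 ≤ r) :
    ‖((r : ℂ) * v) ^ k * weight δ (r * v)‖
      ≤ 2 ^ k * (r ^ k * Real.exp (-(r ^ 3 / 6) + 2 * |δ| * r)) := by
  have hv2 : ‖v‖ ≤ 2 := by
    have := norm_add_le (v - e) e
    rw [sub_add_cancel] at this
    linarith
  rw [norm_mul, norm_pow, norm_mul, Complex.norm_real, Real.norm_of_nonneg hr, ← mul_assoc,
    ← mul_pow, mul_comm (2 : ℝ)]
  gcongr
  exact norm_weight_le_of_sector δ he he1 hv hr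

lemma integrableOn_ray (δ : ℝ) (k : ℕ) {e : ℂ} (he : Complex.I * e ^ 3 = -1) (he1 : ‖e‖ = 1) :
    IntegrableOn (fun t : ℝ => ((t : ℂ) * e) ^ k * weight δ (t * e) * e) (Set.Ioi 0) := by
  refine (integrableOn_cubicBound k |δ|).mono' ?_ ?_
  · refine Continuous.aestronglyMeasurable ?_
    unfold weight
    fun_prop
  · filter_upwards [ae_restrict_mem measurableSet_Ioi] with t ht
    have ht0 : (0 : ℝ) ≤ t := le_of_lt ht
    rw [norm_mul, norm_mul, norm_pow, norm_mul, he1, Complex.norm_real, Real.norm_of_nonneg ht0,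
      mul_one, mul_one, cubicBound, weight, Complex.norm_exp]
    gcongr
    have hsplit : Complex.I * (((t : ℂ) * e) ^ 3 / 3 - δ * (t * e))
        = ((-(t ^ 3 / 3) : ℝ) : ℂ) + ((-(δ * t) : ℝ) : ℂ) * (Complex.I * e) := by
      push_cast
      linear_combination ((t : ℂ) ^ 3 / 3) * he
    rw [hsplit, Complex.add_re, Complex.re_ofReal_mul, Complex.ofReal_re]
    refine add_le_add le_rfl ((le_abs_self _).trans ?_)
    rw [abs_mul, abs_neg, abs_mul, abs_of_nonneg ht0]
    refine mul_le_of_le_one_right (by positivity) ?_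
    refine (Complex.abs_re_le_norm _).trans ?_
    rw [norm_mul, Complex.norm_I, one_mul, he1]

/-- A primitive of `z ^ k exp (i (z³/3 - δ z))` has a limit at infinity in each direction `e`
with `i e³ = -1`: along the ray this is integrability, and the difference between a point and its
radial projection to the ray is controlled by the mean value inequality. -/
lemma tendsto_primitive (δ : ℝ) (k : ℕ) {e : ℂ} (he : Complex.I * e ^ 3 = -1) (he1 : ‖e‖ = 1)
    {F : ℂ → ℂ} (hF : ∀ z, HasDerivAt F (z ^ k * weight δ z) z) {l : Filter ℝ} {z : ℝ → ℂ}
    (hz : Tendsto (fun t => ‖z t‖) l atTop)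
    (hdir : Tendsto (fun t => z t / (‖z t‖ : ℂ)) l (𝓝 e)) :
    Tendsto (fun t => F (z t)) l (𝓝 (F 0 + rayMoment δ k e)) := by
  have hray : Tendsto (fun r : ℝ => F (r * e)) atTop (𝓝 (F 0 + rayMoment δ k e)) := by
    have h1 := intervalIntegral_tendsto_integral_Ioi 0 (integrableOn_ray δ k he he1) tendsto_id
    have h2 := h1.const_add (F 0)
    refine h2.congr fun r => ?_
    have hder : ∀ t : ℝ, HasDerivAt (fun t : ℝ => F (t * e))
        (((t : ℂ) * e) ^ k * weight δ (t * e) * e) t := by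
      intro t
      have hl : HasDerivAt (fun t : ℝ => (t : ℂ) * e) (1 * e) t :=
        Complex.ofRealCLM.hasDerivAt.mul_const e
      rw [one_mul] at hl
      exact (hF (t * e)).comp_of_eq t hl rfl
    rw [intervalIntegral.integral_eq_sub_of_hasDerivAt (fun t _ => hder t)]
    · simp
    · refine Continuous.intervalIntegrable ?_ _ _
      unfold weight
      fun_prop
  have hdiff : Tendsto (fun t => F (z t) - F (‖z t‖ * e)) l (𝓝 0) := by
    have hb := ((tendsto_pow_mul_exp_neg_cube (k + 1) (2 * |δ|)).comp hz).const_mul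
      ((2 : ℝ) ^ k * (1 / 10))
    rw [mul_zero] at hb
    refine squeeze_zero_norm' ?_ hb
    filter_upwards [hdir (Metric.closedBall_mem_nhds e (by norm_num : (0 : ℝ) < 1 / 10)),
      hz.eventually_gt_atTop 0] with t ht ht0
    have hball : Convex ℝ ((fun v : ℂ => (‖z t‖ : ℂ) * v) '' Metric.closedBall e (1 / 10)) :=
      (convex_closedBall e (1 / 10 : ℝ)).linear_image (LinearMap.mulLeft ℝ (‖z t‖ : ℂ))
    have hmv := Convex.norm_image_sub_le_of_norm_hasDerivWithin_le
      (f := F) (s := (fun v : ℂ => (‖z t‖ : ℂ) * v) '' Metric.closedBall e (1 / 10))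
      (x := ‖z t‖ * e) (y := z t)
      (C := 2 ^ k * (‖z t‖ ^ k * Real.exp (-(‖z t‖ ^ 3 / 6) + 2 * |δ| * ‖z t‖)))
      (fun w _ => (hF w).hasDerivWithinAt) ?_ hball
      ⟨e, Metric.mem_closedBall_self (by norm_num), rfl⟩
      ⟨z t / ‖z t‖, ht, mul_div_cancel₀ _ (by exact_mod_cast ht0.ne')⟩
    · refine hmv.trans ?_
      have hd : ‖z t - ‖z t‖ * e‖ ≤ ‖z t‖ * (1 / 10) := by
        have h1 : z t - ‖z t‖ * e = ‖z t‖ * (z t / ‖z t‖ - e) := by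
          rw [mul_sub, mul_div_cancel₀ _ (by exact_mod_cast ht0.ne')]
        rw [h1, norm_mul, Complex.norm_real, norm_norm]
        gcongr
        rwa [Set.mem_preimage, Metric.mem_closedBall, dist_eq_norm] at ht
      calc _ ≤ 2 ^ k * (‖z t‖ ^ k * Real.exp (-(‖z t‖ ^ 3 / 6) + 2 * |δ| * ‖z t‖))
            * (‖z t‖ * (1 / 10)) := by gcongr
        _ = _ := by simp only [Function.comp]; ring
    · rintro _ ⟨v, hv, rfl⟩
      rw [Metric.mem_closedBall, dist_eq_norm] at hv
      exact norm_pow_mul_weight_le δ k he he1 hv ht0.le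
  have := hdiff.add (hray.comp hz)
  rw [zero_add] at this
  refine this.congr fun t => ?_
  simp

lemma hasContourIntegral_of_directions {α β : ℝ} {γ : ℝ → ℂ} (hγ : IsContour α β γ)
    (hα : Complex.I * Complex.exp (α * Complex.I) ^ 3 = -1)
    (hβ : Complex.I * Complex.exp (β * Complex.I) ^ 3 = -1) (δ : ℝ) (k : ℕ) :
    HasContourIntegral γ (fun z => z ^ k * weight δ z)
      (rayMoment δ k (Complex.exp (β * Complex.I))
        - rayMoment δ k (Complex.exp (α * Complex.I))) := by
  obtain ⟨F, hF⟩ := (differentiable_pow_mul_weight δ k).isExactOn_univ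
  have hF' : ∀ z, HasDerivAt F (z ^ k * weight δ z) z := fun z => hF z trivial
  have h1 := tendsto_primitive δ k hβ (Complex.norm_exp_ofReal_mul_I β) hF' hγ.norm_atTop
    hγ.direction_atTop
  have h2 := tendsto_primitive δ k hα (Complex.norm_exp_ofReal_mul_I α) hF' hγ.norm_atBot
    hγ.direction_atBot
  have h3 := (h1.comp tendsto_snd).sub (h2.comp (tendsto_fst (f := atBot) (g := atTop)))
  rw [add_sub_add_left_eq_sub] at h3
  refine h3.congr fun p => ?_
  rw [partialIntegral_eq_sub hγ (differentiable_pow_mul_weight δ k).continuous hF']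
  rfl

lemma cubeRoot_eq_exp : cubeRoot = Complex.exp ((2 * Real.pi / 3 : ℝ) * Complex.I) := by
  have h : 2 * Real.pi / 3 = Real.pi - Real.pi / 3 := by ring
  apply Complex.ext
  · rw [Complex.exp_ofReal_mul_I_re, h, Real.cos_pi_sub, Real.cos_pi_div_three]
    simp [cubeRoot]
  · rw [Complex.exp_ofReal_mul_I_im, h, Real.sin_pi_sub, Real.sin_pi_div_three]
    simp [cubeRoot]

lemma exp_pi_div_six : Complex.exp ((Real.pi / 6 : ℝ) * Complex.I) = -Complex.I * cubeRoot := by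
  apply Complex.ext
  · rw [Complex.exp_ofReal_mul_I_re, Real.cos_pi_div_six]
    simp [cubeRoot]
  · rw [Complex.exp_ofReal_mul_I_im, Real.sin_pi_div_six]
    simp [cubeRoot]

lemma exp_five_pi_div_six : Complex.exp ((5 * Real.pi / 6 : ℝ) * Complex.I)
    = -Complex.I * (starRingEnd ℂ) cubeRoot := by
  have h : 5 * Real.pi / 6 = Real.pi - Real.pi / 6 := by ring
  apply Complex.ext
  · rw [Complex.exp_ofReal_mul_I_re, h, Real.cos_pi_sub, Real.cos_pi_div_six]
    simp [cubeRoot]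
  · rw [Complex.exp_ofReal_mul_I_im, h, Real.sin_pi_sub, Real.sin_pi_div_six]
    simp [cubeRoot]

lemma rayMoment_neg_I_mul_cubeRoot (δ : ℝ) (k : ℕ) :
    rayMoment δ k (-Complex.I * cubeRoot)
      = (-Complex.I) ^ (k + 1) * (cubeRoot ^ (k + 1) * rayIntegral k (-δ)) := by
  rw [rayMoment, rayIntegral, ← mul_assoc, ← integral_const_mul]
  refine integral_congr_ae (Eventually.of_forall fun t => ?_)
  simp only [weight, rayIntegrand]
  have : Complex.I * (((t : ℂ) * (-Complex.I * cubeRoot)) ^ 3 / 3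
      - δ * (t * (-Complex.I * cubeRoot)))
      = -((t : ℂ) ^ 3 / 3) + ((-δ : ℝ) : ℂ) * cubeRoot * t := by
    push_cast
    linear_combination (-(Complex.I ^ 4 * (t : ℂ) ^ 3 / 3)) * cubeRoot_pow_three
      + (t ^ 3 * (1 - Complex.I ^ 2) / 3 + δ * cubeRoot * t) * Complex.I_sq
  rw [this]
  ring

lemma rayMoment_neg_I_mul_conj (δ : ℝ) (k : ℕ) :
    rayMoment δ k (-Complex.I * (starRingEnd ℂ) cubeRoot)
      = (-Complex.I) ^ (k + 1) * (starRingEnd ℂ) (cubeRoot ^ (k + 1) * rayIntegral k (-δ)) := by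
  have h3 : (starRingEnd ℂ) cubeRoot ^ 3 = 1 := by
    rw [← map_pow, cubeRoot_pow_three, map_one]
  rw [rayMoment, rayIntegral, map_mul, map_pow, ← integral_conj, ← mul_assoc,
    ← integral_const_mul]
  refine integral_congr_ae (Eventually.of_forall fun t => ?_)
  simp only [weight, rayIntegrand, map_mul, map_pow, Complex.conj_ofReal, ← Complex.exp_conj,
    map_add, map_neg, map_div₀, map_ofNat]
  have : Complex.I * (((t : ℂ) * (-Complex.I * (starRingEnd ℂ) cubeRoot)) ^ 3 / 3
      - δ * (t * (-Complex.I * (starRingEnd ℂ) cubeRoot)))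
      = -((t : ℂ) ^ 3 / 3) + ((-δ : ℝ) : ℂ) * (starRingEnd ℂ) cubeRoot * t := by
    push_cast
    linear_combination (-(Complex.I ^ 4 * (t : ℂ) ^ 3 / 3)) * h3
      + (t ^ 3 * (1 - Complex.I ^ 2) / 3 + δ * (starRingEnd ℂ) cubeRoot * t) * Complex.I_sq
  rw [this]
  ring

/-- The moments are, up to powers of `-i`, the derivatives of the Airy function at `-δ`. -/
lemma hasContourIntegral_moment {γ : ℝ → ℂ} (hγ : IsContour (5 * Real.pi / 6) (Real.pi / 6) γ)
    (δ : ℝ) (k : ℕ) :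
    HasContourIntegral γ (fun z => z ^ k * weight δ z)
      (2 * Real.pi * (-Complex.I) ^ k * airyDeriv k (-δ)) := by
  have h4 : Complex.I ^ 4 = 1 := Complex.I_pow_four
  have h := hasContourIntegral_of_directions hγ ?_ ?_ δ k
  · convert h using 1
    rw [exp_pi_div_six, exp_five_pi_div_six, rayMoment_neg_I_mul_cubeRoot,
      rayMoment_neg_I_mul_conj, ← mul_sub, Complex.sub_conj, airyDeriv]
    have hpi : (Real.pi : ℂ) ≠ 0 := by exact_mod_cast Real.pi_ne_zero
    generalize (cubeRoot ^ (k + 1) * rayIntegral k (-δ)).im = y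
    push_cast
    field_simp
    rw [pow_succ]
    linear_combination ((-Complex.I) ^ k * (y : ℂ)) * Complex.I_sq
  · rw [exp_five_pi_div_six, mul_pow, ← map_pow, cubeRoot_pow_three, map_one]
    linear_combination -h4
  · rw [exp_pi_div_six, mul_pow, cubeRoot_pow_three]
    linear_combination -h4

lemma HasContourIntegral.contourIntegral_eq {γ : ℝ → ℂ} {f : ℂ → ℂ} {v : ℂ}
    (h : HasContourIntegral γ f v) : contourIntegral γ f = v :=
  Tendsto.limUnder_eq h

lemma moment_eq {γ : ℝ → ℂ} (hγ : IsContour (5 * Real.pi / 6) (Real.pi / 6) γ)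
    (δ : ℝ) (k : ℕ) :
    moment γ δ k = 2 * Real.pi * (-Complex.I) ^ k * airyDeriv k (-δ) :=
  (hasContourIntegral_moment hγ δ k).contourIntegral_eq

lemma hasDerivAt_rays_of_neg (α β : ℝ) {t : ℝ} (ht : t < 0) :
    HasDerivAt (rays α β) (-Complex.exp (α * Complex.I)) t := by
  have h : HasDerivAt (fun t : ℝ => ((-t : ℝ) : ℂ) * Complex.exp (α * Complex.I))
      (((-1 : ℝ) : ℂ) * Complex.exp (α * Complex.I)) t :=
    ((hasDerivAt_neg t).ofReal_comp).mul_const _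
  refine (h.congr_of_eventuallyEq ?_).congr_deriv (by push_cast; ring)
  filter_upwards [Iio_mem_nhds ht] with s hs
  simp [rays, le_of_lt (Set.mem_Iio.1 hs)]

lemma hasDerivAt_rays_of_pos (α β : ℝ) {t : ℝ} (ht : 0 < t) :
    HasDerivAt (rays α β) (Complex.exp (β * Complex.I)) t := by
  have h : HasDerivAt (fun t : ℝ => (t : ℂ) * Complex.exp (β * Complex.I))
      (1 * Complex.exp (β * Complex.I)) t :=
    (Complex.ofRealCLM.hasDerivAt).mul_const _
  refine (h.congr_of_eventuallyEq ?_).congr_deriv (by ring)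
  filter_upwards [Ioi_mem_nhds ht] with s hs
  simp [rays, not_le.2 (Set.mem_Ioi.1 hs)]

lemma norm_rays (α β t : ℝ) : ‖rays α β t‖ = |t| := by
  unfold rays
  split_ifs with h
  · rw [norm_mul, Complex.norm_exp_ofReal_mul_I, Complex.norm_real, mul_one, norm_neg,
      Real.norm_eq_abs]
  · rw [norm_mul, Complex.norm_exp_ofReal_mul_I, Complex.norm_real, mul_one, Real.norm_eq_abs]

lemma isContour_rays (α β : ℝ) : IsContour α β (rays α β) where
  continuous := by
    unfold rays
    refine Continuous.if_le (by fun_prop) (by fun_prop) continuous_id continuous_const ?_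
    rintro t rfl
    simp
  differentiable := by
    refine ⟨{0}, Set.countable_singleton 0, fun t ht => ?_⟩
    rcases lt_or_gt_of_ne ht with h | h
    · exact (hasDerivAt_rays_of_neg α β h).differentiableAt
    · exact (hasDerivAt_rays_of_pos α β h).differentiableAt
  deriv_integrable a b := by
    refine (intervalIntegrable_const (c := (1 : ℝ))).mono_fun
      (measurable_deriv _).aestronglyMeasurable ?_
    refine ae_restrict_of_ae ?_
    have h0 : ∀ᵐ t : ℝ, t ≠ 0 := by simp [ae_iff]
    filter_upwards [h0] with t ht
    rcases lt_or_gt_of_ne ht with h | h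
    · rw [(hasDerivAt_rays_of_neg α β h).deriv, norm_neg, Complex.norm_exp_ofReal_mul_I]
      simp
    · rw [(hasDerivAt_rays_of_pos α β h).deriv, Complex.norm_exp_ofReal_mul_I]
      simp
  norm_atBot := by simpa only [norm_rays] using tendsto_abs_atBot_atTop
  norm_atTop := by simpa only [norm_rays] using tendsto_abs_atTop_atTop
  direction_atBot := by
    refine tendsto_const_nhds.congr' ?_
    filter_upwards [eventually_lt_atBot 0] with t ht
    have : ((-t : ℝ) : ℂ) ≠ 0 := by exact_mod_cast (neg_pos.2 ht).ne'
    rw [norm_rays, abs_of_neg ht, rays, if_pos ht.le, mul_div_cancel_left₀ _ this]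
  direction_atTop := by
    refine tendsto_const_nhds.congr' ?_
    filter_upwards [eventually_gt_atTop 0] with t ht
    have : ((t : ℝ) : ℂ) ≠ 0 := by exact_mod_cast ht.ne'
    rw [norm_rays, abs_of_pos ht, rays, if_neg (not_le.2 ht), mul_div_cancel_left₀ _ this]

/-- The rotation `s = i z` carries the rays at `5π/6` and `π/6` to those at `∓2π/3`. -/
lemma rays_eq_I_mul (t : ℝ) :
    rays (-(2 * Real.pi / 3)) (2 * Real.pi / 3) t
      = Complex.I * rays (5 * Real.pi / 6) (Real.pi / 6) t := by
  have h1 : Complex.exp ((-(2 * Real.pi / 3) : ℝ) * Complex.I)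
      = Complex.I * Complex.exp ((5 * Real.pi / 6 : ℝ) * Complex.I) := by
    rw [exp_five_pi_div_six, cubeRoot_eq_exp, ← Complex.exp_conj, map_mul, Complex.conj_ofReal,
      Complex.conj_I, ← mul_assoc, mul_neg, Complex.I_mul_I, neg_neg, one_mul]
    push_cast
    ring_nf
  have h2 : Complex.exp ((2 * Real.pi / 3 : ℝ) * Complex.I)
      = Complex.I * Complex.exp ((Real.pi / 6 : ℝ) * Complex.I) := by
    rw [exp_pi_div_six, ← cubeRoot_eq_exp, ← mul_assoc, mul_neg, Complex.I_mul_I, neg_neg, one_mul]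
  unfold rays
  split_ifs
  · rw [h1]; ring
  · rw [h2]; ring

lemma Ai_ofReal (x : ℝ) : Ai x = airyDeriv 0 x := by
  have h := hasContourIntegral_moment (isContour_rays (5 * Real.pi / 6) (Real.pi / 6)) (-x) 0
  have h2 : HasContourIntegral (rays (-(2 * Real.pi / 3)) (2 * Real.pi / 3))
      (fun s => Complex.exp (-(s ^ 3 / 3) + x * s))
      (Complex.I * (2 * Real.pi * (-Complex.I) ^ 0 * airyDeriv 0 (-(-x)))) := by
    refine (Tendsto.const_mul Complex.I h).congr fun p => ?_
    rw [partialIntegral, partialIntegral, ← intervalIntegral.integral_const_mul]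
    refine intervalIntegral.integral_congr fun t _ => ?_
    have hrays : rays (-(2 * Real.pi / 3)) (2 * Real.pi / 3)
        = fun t => Complex.I * rays (5 * Real.pi / 6) (Real.pi / 6) t := funext rays_eq_I_mul
    simp only [hrays, weight, deriv_const_mul_field', pow_zero, one_mul]
    have : Complex.I * (rays (5 * Real.pi / 6) (Real.pi / 6) t ^ 3 / 3
        - ((-x : ℝ) : ℂ) * rays (5 * Real.pi / 6) (Real.pi / 6) t)
        = -((Complex.I * rays (5 * Real.pi / 6) (Real.pi / 6) t) ^ 3 / 3)
          + x * (Complex.I * rays (5 * Real.pi / 6) (Real.pi / 6) t) := by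
      push_cast
      linear_combination (Complex.I * rays (5 * Real.pi / 6) (Real.pi / 6) t ^ 3 / 3)
        * Complex.I_sq
    rw [this]
    ring
  rw [Ai, h2.contourIntegral_eq, neg_neg, pow_zero, mul_one]
  have hpi : (Real.pi : ℂ) ≠ 0 := by exact_mod_cast Real.pi_ne_zero
  field_simp

/-! ### Positivity of the Airy function on the positive half-line -/

lemma hasDerivAt_airyDeriv_one (x : ℝ) : HasDerivAt (airyDeriv 1) (x * airyDeriv 0 x) x :=
  airyDeriv_two x ▸ hasDerivAt_airyDeriv 1 x

lemma monotoneOn_of_hasDerivAt_nonneg {f f' : ℝ → ℝ} {s : Set ℝ} (hs : Convex ℝ s)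
    (hf : ∀ x ∈ s, HasDerivAt f (f' x) x) (hf' : ∀ x ∈ s, 0 ≤ f' x) : MonotoneOn f s :=
  monotoneOn_of_hasDerivWithinAt_nonneg hs
    (fun x hx => (hf x hx).continuousAt.continuousWithinAt)
    (fun x hx => (hf x (interior_subset hx)).hasDerivWithinAt)
    (fun x hx => hf' x (interior_subset hx))

lemma airyDeriv_zero_mul_one_nonpos {x : ℝ} (hx : 0 ≤ x) :
    airyDeriv 0 x * airyDeriv 1 x ≤ 0 := by
  have hm : MonotoneOn (fun x => airyDeriv 0 x * airyDeriv 1 x) (Set.Ici 0) :=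
    monotoneOn_of_hasDerivAt_nonneg (convex_Ici 0)
      (fun y _ => (hasDerivAt_airyDeriv 0 y).mul (hasDerivAt_airyDeriv_one y))
      (fun y hy => by
        have hy0 : (0 : ℝ) ≤ y := hy
        nlinarith [mul_nonneg hy0 (sq_nonneg (airyDeriv 0 y)), sq_nonneg (airyDeriv 1 y)])
  refine ge_of_tendsto tendsto_airyDeriv_zero_mul_one ?_
  filter_upwards [eventually_ge_atTop x] with y hy
  exact hm hx (hx.trans hy) hy

lemma antitoneOn_airy_sq : AntitoneOn (fun x => airyDeriv 0 x ^ 2) (Set.Ici 0) := by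
  have hm : MonotoneOn (fun x => -airyDeriv 0 x ^ 2) (Set.Ici 0) :=
    monotoneOn_of_hasDerivAt_nonneg (convex_Ici 0)
      (fun y _ => ((hasDerivAt_airyDeriv 0 y).pow 2).neg)
      (fun y hy => by
        have := airyDeriv_zero_mul_one_nonpos (x := y) hy
        simp only [Nat.cast_ofNat, Nat.add_one_sub_one, pow_one, zero_add]
        linarith)
  intro x hx y hy hxy
  have := hm hx hy hxy
  simp only at this ⊢
  linarith

/-- A zero at `x ≥ 0` would force the Airy function to vanish to the right of `x`; but
`(Ai² + Ai'²) exp (x + x²/2)` is nondecreasing on the half-line and positive at `0`. -/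
lemma airyDeriv_zero_ne_zero {x : ℝ} (hx : 0 ≤ x) : airyDeriv 0 x ≠ 0 := by
  intro h0
  have hz : ∀ y, x ≤ y → airyDeriv 0 y = 0 := by
    intro y hy
    have := antitoneOn_airy_sq hx (hx.trans hy) hy
    simp only [h0] at this
    nlinarith [sq_nonneg (airyDeriv 0 y)]
  have hz1 : airyDeriv 1 (x + 1) = 0 := by
    refine (hasDerivAt_airyDeriv 0 (x + 1)).unique ?_
    refine (hasDerivAt_const (x + 1) (0 : ℝ)).congr_of_eventuallyEq ?_
    filter_upwards [Ioi_mem_nhds (lt_add_one x)] with y hy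
    exact hz y (le_of_lt hy)
  have hm : MonotoneOn (fun x => (airyDeriv 0 x ^ 2 + airyDeriv 1 x ^ 2)
      * Real.exp (x + x ^ 2 / 2)) (Set.Ici 0) := by
    refine monotoneOn_of_hasDerivAt_nonneg (f' := fun y => (1 + y)
      * (airyDeriv 0 y + airyDeriv 1 y) ^ 2 * Real.exp (y + y ^ 2 / 2)) (convex_Ici 0)
      (fun y _ => ?_) (fun y hy => ?_)
    · have h1 := (((hasDerivAt_airyDeriv 0 y).pow 2).add ((hasDerivAt_airyDeriv_one y).pow 2)).mul
        (((hasDerivAt_id y).add (((hasDerivAt_id y).pow 2).div_const 2)).exp)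
      refine h1.congr_deriv ?_
      simp
      ring
    · have : (0 : ℝ) ≤ y := hy
      positivity
  have := hm (Set.self_mem_Ici) (show (0 : ℝ) ≤ x + 1 by linarith) (by linarith)
  simp only [hz (x + 1) (by linarith), hz1] at this
  have hp := airyDeriv_zero_pos
  norm_num at this
  nlinarith [sq_nonneg (airyDeriv 1 0)]

/-- A zero-free interval around `0` is an interval of positivity. -/
lemma airyDeriv_zero_pos_of_ne_zero {s : Set ℝ} (hs : Set.OrdConnected s) (h0 : (0 : ℝ) ∈ s)
    (hne : ∀ x ∈ s, airyDeriv 0 x ≠ 0) {x : ℝ} (hx : x ∈ s) : 0 < airyDeriv 0 x := by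
  by_contra hneg
  obtain ⟨y, hy, hy0⟩ := (hs.isPreconnected).intermediate_value hx h0
    (continuous_airyDeriv 0).continuousOn ⟨not_lt.1 hneg, airyDeriv_zero_pos.le⟩
  exact hne y hy hy0

lemma airyDeriv_zero_pos_of_nonneg {x : ℝ} (hx : 0 ≤ x) : 0 < airyDeriv 0 x :=
  airyDeriv_zero_pos_of_ne_zero (s := Set.Ici 0) Set.ordConnected_Ici Set.self_mem_Ici
    (fun _ h => airyDeriv_zero_ne_zero h) hx

lemma airyDeriv_one_nonpos {x : ℝ} (hx : 0 ≤ x) : airyDeriv 1 x ≤ 0 := by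
  have h1 := airyDeriv_zero_mul_one_nonpos hx
  have h2 := airyDeriv_zero_pos_of_nonneg hx
  by_contra h
  nlinarith [mul_pos h2 (not_le.1 h)]

/-! ### Location of the largest zero -/

/-- Comparison of the Airy function with an approximate solution `u'' = x u + e`: the derivative
of the Wronskian `Ai' u - Ai u'` is `-Ai e`. -/
lemma wronskian_le {u u' e : ℝ → ℝ} (hu : ∀ x, HasDerivAt u (u' x) x)
    (hu' : ∀ x, HasDerivAt u' (x * u x + e x) x) {a b : ℝ} (hab : a ≤ b)
    (h : ∀ x ∈ Set.Icc a b, 0 ≤ airyDeriv 0 x * e x) :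
    airyDeriv 1 b * u b - airyDeriv 0 b * u' b ≤ airyDeriv 1 a * u a - airyDeriv 0 a * u' a := by
  have hm : MonotoneOn (fun x => -(airyDeriv 1 x * u x - airyDeriv 0 x * u' x)) (Set.Icc a b) :=
    monotoneOn_of_hasDerivAt_nonneg (f' := fun x => airyDeriv 0 x * e x) (convex_Icc a b)
      (fun x _ => ((((hasDerivAt_airyDeriv_one x).mul (hu x)).sub
        ((hasDerivAt_airyDeriv 0 x).mul (hu' x))).neg).congr_deriv (by ring)) h
  have := hm (Set.left_mem_Icc.2 hab) (Set.right_mem_Icc.2 hab) hab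
  simp only at this
  linarith

lemma le_wronskian {u u' e : ℝ → ℝ} (hu : ∀ x, HasDerivAt u (u' x) x)
    (hu' : ∀ x, HasDerivAt u' (x * u x + e x) x) {a b : ℝ} (hab : a ≤ b)
    (h : ∀ x ∈ Set.Icc a b, airyDeriv 0 x * e x ≤ 0) :
    airyDeriv 1 a * u a - airyDeriv 0 a * u' a ≤ airyDeriv 1 b * u b - airyDeriv 0 b * u' b := by
  have := wronskian_le (u := fun x => -u x) (u' := fun x => -u' x) (e := fun x => -e x)
    (fun x => (hu x).neg) (fun x => (hu' x).neg.congr_deriv (by ring)) hab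
    (fun x hx => by have := h x hx; linarith)
  linarith

/-- Maclaurin coefficients (of `x ^ (3 k)`) of the solution of Airy's equation with initial
values `1, 0`. -/
def evenCoeff : ℕ → ℝ
  | 0 => 1
  | k + 1 => evenCoeff k / ((3 * k + 2) * (3 * k + 3))

/-- Maclaurin coefficients (of `x ^ (3 k + 1)`) of the solution of Airy's equation with initial
values `0, 1`. -/
def oddCoeff : ℕ → ℝ
  | 0 => 1
  | k + 1 => oddCoeff k / ((3 * k + 3) * (3 * k + 4))

/-- A truncated Maclaurin series of the solution of Airy's equation with initial values
`1, -ρ`. -/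
def truncAiry (N M : ℕ) (ρ x : ℝ) : ℝ :=
  ∑ k ∈ Finset.range (N + 1), evenCoeff k * x ^ (3 * k)
    - ρ * ∑ k ∈ Finset.range (M + 1), oddCoeff k * x ^ (3 * k + 1)

/-- The derivative of `truncAiry`. -/
def truncAiry' (N M : ℕ) (ρ x : ℝ) : ℝ :=
  ∑ k ∈ Finset.range (N + 1), evenCoeff k * ((3 * k : ℕ) * x ^ (3 * k - 1))
    - ρ * ∑ k ∈ Finset.range (M + 1), oddCoeff k * ((3 * k + 1 : ℕ) * x ^ (3 * k))

lemma hasDerivAt_truncAiry (N M : ℕ) (ρ x : ℝ) :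
    HasDerivAt (truncAiry N M ρ) (truncAiry' N M ρ x) x :=
  (HasDerivAt.fun_sum fun k _ => (hasDerivAt_pow (3 * k) x).const_mul _).sub
    ((HasDerivAt.fun_sum fun k _ => (hasDerivAt_pow (3 * k + 1) x).const_mul _).const_mul ρ)

lemma hasDerivAt_even_sum (N : ℕ) (x : ℝ) :
    HasDerivAt (fun x => ∑ k ∈ Finset.range (N + 1),
        evenCoeff k * ((3 * k : ℕ) * x ^ (3 * k - 1)))
      (x * ∑ k ∈ Finset.range (N + 1), evenCoeff k * x ^ (3 * k)
        - evenCoeff N * x ^ (3 * N + 1)) x := by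
  induction N with
  | zero =>
    simp only [zero_add, Finset.sum_range_one, evenCoeff, mul_zero, Nat.cast_zero, zero_mul]
    exact (hasDerivAt_const x (0 : ℝ)).congr_deriv (by ring)
  | succ N ih =>
    simp only [Finset.sum_range_succ _ (N + 1)]
    refine (ih.add (((hasDerivAt_pow (3 * (N + 1) - 1) x).const_mul
      ((3 * (N + 1) : ℕ) : ℝ)).const_mul (evenCoeff (N + 1)))).congr_deriv ?_
    have h1 : 3 * (N + 1) - 1 - 1 = 3 * N + 1 := by omega
    have h2 : ((3 * (N + 1) - 1 : ℕ) : ℝ) = 3 * N + 2 := by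
      rw [show 3 * (N + 1) - 1 = 3 * N + 2 by omega]; push_cast; ring
    rw [h1, h2, evenCoeff]
    push_cast
    field_simp
    ring

lemma hasDerivAt_odd_sum (M : ℕ) (x : ℝ) :
    HasDerivAt (fun x => ∑ k ∈ Finset.range (M + 1),
        oddCoeff k * ((3 * k + 1 : ℕ) * x ^ (3 * k)))
      (x * ∑ k ∈ Finset.range (M + 1), oddCoeff k * x ^ (3 * k + 1)
        - oddCoeff M * x ^ (3 * M + 2)) x := by
  induction M with
  | zero =>
    simp only [zero_add, Finset.sum_range_one, oddCoeff, mul_zero, pow_zero]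
    exact (hasDerivAt_const x _).congr_deriv (by ring)
  | succ M ih =>
    simp only [Finset.sum_range_succ _ (M + 1)]
    refine (ih.add (((hasDerivAt_pow (3 * (M + 1)) x).const_mul
      ((3 * (M + 1) + 1 : ℕ) : ℝ)).const_mul (oddCoeff (M + 1)))).congr_deriv ?_
    have h1 : 3 * (M + 1) - 1 = 3 * M + 2 := by omega
    rw [h1, oddCoeff]
    push_cast
    field_simp
    ring

lemma hasDerivAt_truncAiry' (N M : ℕ) (ρ x : ℝ) :
    HasDerivAt (truncAiry' N M ρ) (x * truncAiry N M ρ x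
      + (ρ * (oddCoeff M * x ^ (3 * M + 2)) - evenCoeff N * x ^ (3 * N + 1))) x := by
  refine ((hasDerivAt_even_sum N x).sub ((hasDerivAt_odd_sum M x).const_mul ρ)).congr_deriv ?_
  rw [truncAiry]
  ring

lemma truncAiry_zero (N M : ℕ) (ρ : ℝ) : truncAiry N M ρ 0 = 1 := by
  rw [truncAiry, Finset.sum_range_succ', Finset.sum_eq_zero, Finset.sum_eq_zero]
  · simp [evenCoeff]
  · intro k _; simp
  · intro k _; simp

lemma truncAiry'_zero (N M : ℕ) (ρ : ℝ) : truncAiry' N M ρ 0 = -ρ := by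
  rw [truncAiry', Finset.sum_range_succ', Finset.sum_eq_zero, Finset.sum_range_succ',
    Finset.sum_eq_zero]
  · simp [oddCoeff]
  · intro k _; simp
  · intro k _
    have : 3 * (k + 1) - 1 ≠ 0 := by omega
    simp [this]

lemma evenCoeff_pos (k : ℕ) : 0 < evenCoeff k := by
  induction k with
  | zero => simp [evenCoeff]
  | succ k ih => rw [evenCoeff]; positivity

lemma oddCoeff_pos (k : ℕ) : 0 < oddCoeff k := by
  induction k with
  | zero => simp [oddCoeff]
  | succ k ih => rw [oddCoeff]; positivity

/-- The comparison function is a subsolution on `[0, 3]` with `u, u' ≥ 0` at `3`, where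
`Ai > 0 ≥ Ai'`. The true value of `-Ai'(0) / Ai(0)` is `0.72901…`; the bracket `[0.7271, 0.7303]`
lies strictly inside the interval of slopes `[0.727, 0.7304]` used to the left of `0`. -/
lemma logDeriv_zero_lower : 0.7271 * airyDeriv 0 0 ≤ -airyDeriv 1 0 := by
  have h := le_wronskian (hasDerivAt_truncAiry 5 5 0.7271) (hasDerivAt_truncAiry' 5 5 0.7271)
    (show (0 : ℝ) ≤ 3 by norm_num) ?_
  · rw [truncAiry_zero, truncAiry'_zero] at h
    have h1 : 0 ≤ truncAiry 5 5 0.7271 3 := by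
      norm_num [truncAiry, Finset.sum_range_succ, evenCoeff, oddCoeff]
    have h2 : 0 ≤ truncAiry' 5 5 0.7271 3 := by
      norm_num [truncAiry', Finset.sum_range_succ, evenCoeff, oddCoeff]
    have h3 := airyDeriv_zero_pos_of_nonneg (show (0 : ℝ) ≤ 3 by norm_num)
    have h4 := airyDeriv_one_nonpos (show (0 : ℝ) ≤ 3 by norm_num)
    nlinarith [mul_nonneg h3.le h2, mul_nonneg (neg_nonneg.2 h4) h1]
  · intro x hx
    refine mul_nonpos_of_nonneg_of_nonpos (airyDeriv_zero_pos_of_nonneg hx.1).le ?_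
    have h1 : 0.7271 * (oddCoeff 5 * x ^ (3 * 5 + 2)) - evenCoeff 5 * x ^ (3 * 5 + 1)
        = (0.7271 * oddCoeff 5 * x - evenCoeff 5) * x ^ 16 := by ring
    rw [h1]
    refine mul_nonpos_of_nonpos_of_nonneg ?_ (by positivity)
    norm_num [evenCoeff, oddCoeff]
    linarith [hx.2]

/-- The comparison function is a supersolution on `[0, 3]` with `u, u' ≤ 0` at `3`. -/
lemma logDeriv_zero_upper : -airyDeriv 1 0 ≤ 0.7303 * airyDeriv 0 0 := by
  have h := wronskian_le (hasDerivAt_truncAiry 6 5 0.7303) (hasDerivAt_truncAiry' 6 5 0.7303)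
    (show (0 : ℝ) ≤ 3 by norm_num) ?_
  · rw [truncAiry_zero, truncAiry'_zero] at h
    have h1 : truncAiry 6 5 0.7303 3 ≤ 0 := by
      norm_num [truncAiry, Finset.sum_range_succ, evenCoeff, oddCoeff]
    have h2 : truncAiry' 6 5 0.7303 3 ≤ 0 := by
      norm_num [truncAiry', Finset.sum_range_succ, evenCoeff, oddCoeff]
    have h3 := airyDeriv_zero_pos_of_nonneg (show (0 : ℝ) ≤ 3 by norm_num)
    have h4 := airyDeriv_one_nonpos (show (0 : ℝ) ≤ 3 by norm_num)
    nlinarith [mul_nonneg h3.le (neg_nonneg.2 h2), mul_nonneg (neg_nonneg.2 h4) (neg_nonneg.2 h1)]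
  · intro x hx
    refine mul_nonneg (airyDeriv_zero_pos_of_nonneg hx.1).le ?_
    have h1 : 0.7303 * (oddCoeff 5 * x ^ (3 * 5 + 2)) - evenCoeff 6 * x ^ (3 * 6 + 1)
        = (0.7303 * oddCoeff 5 - evenCoeff 6 * x ^ 2) * x ^ 17 := by ring
    rw [h1]
    refine mul_nonneg ?_ (pow_nonneg hx.1 _)
    norm_num [evenCoeff, oddCoeff]
    nlinarith [hx.1, hx.2]

/-- A bound for the first terms of `-truncAiry' N N ρ (-y)`, `N ≥ 2`: the factors
`1 / 2 - y³ / 30` and `1 / 3 - y³ / 72` stay positive in this range. -/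
lemma truncAiry'_nonneg_aux {ρ y : ℝ} (hρ : 0.72 ≤ ρ) (hρ' : ρ ≤ 0.74) (hy : 1.5 ≤ y)
    (hy' : y ≤ 2.34) : ρ - y ^ 2 / 2 - ρ * y ^ 3 / 3 + y ^ 5 / 30 + ρ * y ^ 6 / 72 ≤ 0 := by
  have h3 : y ^ 3 ≤ 2.34 ^ 3 := by gcongr
  have h3' : 1.5 ^ 3 ≤ y ^ 3 := by gcongr
  rcases le_total y 1.9 with h | h
  · have k3 : y ^ 3 ≤ 1.9 ^ 3 := by gcongr
    have e1 : 1.5 ^ 2 * 0.27 ≤ y ^ 2 * (1 / 2 - y ^ 3 / 30) := by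
      gcongr
      linarith
    have e2 : 1.5 ^ 3 * 0.23 ≤ y ^ 3 * (1 / 3 - y ^ 3 / 72) := by
      gcongr
      linarith
    nlinarith
  · have k3 : 1.9 ^ 3 ≤ y ^ 3 := by gcongr
    have e1 : 1.9 ^ 2 * 0.07 ≤ y ^ 2 * (1 / 2 - y ^ 3 / 30) := by
      gcongr
      linarith
    have e2 : 1.9 ^ 3 * 0.15 ≤ y ^ 3 * (1 / 3 - y ^ 3 / 72) := by
      gcongr
      linarith
    nlinarith

/-- The terms of the alternating sum beyond the first ones are paired, using `y³ ≤ 13`. -/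
lemma truncAiry'_five_nonneg {x : ℝ} (hx : -2.34 ≤ x) (hx' : x ≤ -1.5) :
    0 ≤ truncAiry' 5 5 0.727 x := by
  obtain ⟨y, rfl⟩ : ∃ y, x = -y := ⟨-x, by ring⟩
  have hy : 1.5 ≤ y := by linarith
  have hy' : y ≤ 2.34 := by linarith
  have h0 := truncAiry'_nonneg_aux (ρ := 0.727) (by norm_num) (by norm_num) hy hy'
  have h3 : y ^ 3 ≤ 2.34 ^ 3 := by gcongr
  have hy0 : 0 ≤ y := by linarith
  have e1 := mul_nonneg (pow_nonneg hy0 8) (by linarith : 0 ≤ 13 - y ^ 3)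
  have e2 := mul_nonneg (pow_nonneg hy0 9) (by linarith : 0 ≤ 13 - y ^ 3)
  have e3 := pow_nonneg hy0 14
  have e4 := pow_nonneg hy0 15
  have e5 := pow_nonneg hy0 8
  have e6 := pow_nonneg hy0 9
  norm_num [truncAiry', Finset.sum_range_succ, evenCoeff, oddCoeff]
  ring_nf at h0 e1 e2 e3 e4 ⊢
  linarith

lemma truncAiry'_six_nonneg {x : ℝ} (hx : -2.34 ≤ x) (hx' : x ≤ -1.5) :
    0 ≤ truncAiry' 6 6 0.7304 x := by
  obtain ⟨y, rfl⟩ : ∃ y, x = -y := ⟨-x, by ring⟩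
  have hy : 1.5 ≤ y := by linarith
  have hy' : y ≤ 2.34 := by linarith
  have h0 := truncAiry'_nonneg_aux (ρ := 0.7304) (by norm_num) (by norm_num) hy hy'
  have h3 : y ^ 3 ≤ 2.34 ^ 3 := by gcongr
  have hy0 : 0 ≤ y := by linarith
  have e1 := mul_nonneg (pow_nonneg hy0 8) (by linarith : 0 ≤ 13 - y ^ 3)
  have e2 := mul_nonneg (pow_nonneg hy0 9) (by linarith : 0 ≤ 13 - y ^ 3)
  have e3 := mul_nonneg (pow_nonneg hy0 14) (by linarith : 0 ≤ 13 - y ^ 3)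
  have e4 := mul_nonneg (pow_nonneg hy0 15) (by linarith : 0 ≤ 13 - y ^ 3)
  have e5 := pow_nonneg hy0 8
  have e6 := pow_nonneg hy0 9
  have e7 := pow_nonneg hy0 14
  have e8 := pow_nonneg hy0 15
  norm_num [truncAiry', Finset.sum_range_succ, evenCoeff, oddCoeff]
  ring_nf at h0 e1 e2 e3 e4 ⊢
  linarith

lemma truncAiry_five_pos {x : ℝ} (hx : -2.3375 ≤ x) (hx' : x ≤ 0) :
    0 < truncAiry 5 5 0.727 x := by
  rcases le_total x (-1.5) with h | h
  · have hm : MonotoneOn (truncAiry 5 5 0.727) (Set.Icc (-2.3375) (-1.5)) :=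
      monotoneOn_of_hasDerivAt_nonneg (convex_Icc _ _) (fun y _ => hasDerivAt_truncAiry _ _ _ y)
        (fun y hy => truncAiry'_five_nonneg (by linarith [hy.1]) hy.2)
    refine lt_of_lt_of_le ?_ (hm ⟨le_rfl, by norm_num⟩ ⟨hx, h⟩ hx)
    norm_num [truncAiry, Finset.sum_range_succ, evenCoeff, oddCoeff]
  · obtain ⟨y, rfl⟩ : ∃ y, x = -y := ⟨-x, by ring⟩
    have hy : 0 ≤ y := by linarith
    have hy' : y ≤ 1.5 := by linarith
    have h3 : y ^ 3 ≤ 1.5 ^ 3 := by gcongr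
    have h0 : 0 < 1 + 0.727 * y - y ^ 3 / 6 - 0.727 * y ^ 4 / 12 := by
      nlinarith [mul_le_mul_of_nonneg_left h3 hy]
    have e1 := mul_nonneg (pow_nonneg hy 6) (by linarith : 0 ≤ 13 - y ^ 3)
    have e2 := mul_nonneg (pow_nonneg hy 7) (by linarith : 0 ≤ 13 - y ^ 3)
    have e3 := mul_nonneg (pow_nonneg hy 12) (by linarith : 0 ≤ 13 - y ^ 3)
    have e4 := mul_nonneg (pow_nonneg hy 13) (by linarith : 0 ≤ 13 - y ^ 3)
    have e5 := pow_nonneg hy 12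
    have e6 := pow_nonneg hy 13
    have e7 := pow_nonneg hy 6
    have e8 := pow_nonneg hy 7
    norm_num [truncAiry, Finset.sum_range_succ, evenCoeff, oddCoeff]
    ring_nf at h0 e1 e2 e3 e4 ⊢
    linarith

/-- A function that is positive to the right of a zero has a nonnegative derivative there. -/
lemma deriv_nonneg_of_pos_right {f : ℝ → ℝ} {f' a b : ℝ} (hf : HasDerivAt f f' a) (hab : a < b)
    (h0 : f a = 0) (hpos : ∀ x ∈ Set.Ioc a b, 0 < f x) : 0 ≤ f' := by
  have h1 := hasDerivWithinAt_iff_tendsto_slope' (s := Set.Ioi a) (by simp) |>.1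
    hf.hasDerivWithinAt
  refine ge_of_tendsto h1 ?_
  filter_upwards [Ioc_mem_nhdsGT hab] with x hx
  rw [slope_def_field, h0, sub_zero]
  exact div_nonneg (hpos x hx).le (sub_nonneg.2 hx.1.le)

lemma isClosed_airy_zeros : IsClosed {x | airyDeriv 0 x = 0} :=
  isClosed_eq (continuous_airyDeriv 0) continuous_const

/-- At a largest zero in `[-2.3375, 0]`, the Wronskian with a positive subsolution
whose slope at `0` is slightly too small would have the wrong sign there. -/
lemma airy_ne_zero_of_ge {x : ℝ} (hx : -2.3375 ≤ x) : airyDeriv 0 x ≠ 0 := by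
  intro hx0
  have hneg : x < 0 := by
    by_contra h
    exact airyDeriv_zero_ne_zero (not_lt.1 h) hx0
  obtain ⟨z, ⟨hz, hz0⟩, hmax⟩ := (isCompact_Icc.inter_right isClosed_airy_zeros).exists_isGreatest
    (⟨x, ⟨hx, hneg.le⟩, hx0⟩ : (Set.Icc (-2.3375 : ℝ) 0 ∩ {x | airyDeriv 0 x = 0}).Nonempty)
  have hz0' : airyDeriv 0 z = 0 := hz0
  have hzneg : z < 0 := by
    refine lt_of_le_of_ne hz.2 ?_
    rintro rfl
    exact airyDeriv_zero_pos.ne' hz0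
  have hpos : ∀ y ∈ Set.Ioc z 0, 0 < airyDeriv 0 y := fun y hy =>
    airyDeriv_zero_pos_of_ne_zero Set.ordConnected_Ioc ⟨hzneg, le_rfl⟩
      (fun w hw hw0 => absurd (hmax ⟨⟨hz.1.trans hw.1.le, hw.2⟩, hw0⟩) (not_le.2 hw.1)) hy
  have hd := deriv_nonneg_of_pos_right (hasDerivAt_airyDeriv 0 z) hzneg hz0 hpos
  have hW := le_wronskian (hasDerivAt_truncAiry 5 5 0.727) (hasDerivAt_truncAiry' 5 5 0.727)
    hzneg.le ?_
  · rw [truncAiry_zero, truncAiry'_zero, hz0'] at hW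
    have h1 := truncAiry_five_pos hz.1 hz.2
    have h2 := logDeriv_zero_lower
    have h3 : 0 ≤ airyDeriv 1 z * truncAiry 5 5 0.727 z := mul_nonneg hd h1.le
    have h4 := airyDeriv_zero_pos
    linarith
  · intro y hy
    refine mul_nonpos_of_nonneg_of_nonpos ?_ ?_
    · rcases hy.1.eq_or_lt with rfl | h
      · exact hz0.ge
      · exact (hpos y ⟨h, hy.2⟩).le
    · have h1 : 0.727 * (oddCoeff 5 * y ^ (3 * 5 + 2)) - evenCoeff 5 * y ^ (3 * 5 + 1)
          = (0.727 * oddCoeff 5 * y - evenCoeff 5) * y ^ 16 := by ring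
      rw [h1]
      refine mul_nonpos_of_nonpos_of_nonneg ?_ (by positivity)
      nlinarith [evenCoeff_pos 5, oddCoeff_pos 5, hy.2]

/-- Otherwise `Ai > 0` on `(-2.3385, 0]`; the comparison function is a supersolution that vanishes
in this interval, which contradicts its initial slope `-0.7304 < Ai'(0) / Ai(0)`. -/
lemma exists_airy_zero : ∃ x, -2.3385 < x ∧ airyDeriv 0 x = 0 := by
  by_contra! hne
  have hpos : ∀ y ∈ Set.Ioc (-2.3385 : ℝ) 0, 0 < airyDeriv 0 y := fun y hy =>
    airyDeriv_zero_pos_of_ne_zero Set.ordConnected_Ioc ⟨by norm_num, le_rfl⟩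
      (fun w hw => hne w hw.1) hy
  have hend : truncAiry 6 6 0.7304 (-2.3385) < 0 := by
    norm_num [truncAiry, Finset.sum_range_succ, evenCoeff, oddCoeff]
  have hmid : 0 < truncAiry 6 6 0.7304 (-1.5) := by
    norm_num [truncAiry, Finset.sum_range_succ, evenCoeff, oddCoeff]
  have hcont : Continuous (truncAiry 6 6 0.7304) :=
    continuous_iff_continuousAt.2 fun x => (hasDerivAt_truncAiry _ _ _ x).continuousAt
  obtain ⟨z, hz, hz0⟩ := intermediate_value_Ioo (show (-2.3385 : ℝ) ≤ -1.5 by norm_num)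
    hcont.continuousOn ⟨hend, hmid⟩
  have hW := wronskian_le (hasDerivAt_truncAiry 6 6 0.7304) (hasDerivAt_truncAiry' 6 6 0.7304)
    (show z ≤ 0 by linarith [hz.2]) ?_
  · rw [truncAiry_zero, truncAiry'_zero, hz0] at hW
    have h1 := truncAiry'_six_nonneg (by linarith [hz.1]) hz.2.le
    have h2 := logDeriv_zero_upper
    have h3 := hpos z ⟨hz.1, by linarith [hz.2]⟩
    have h4 := airyDeriv_zero_pos
    nlinarith [mul_nonneg h3.le h1]
  · intro y hy
    refine mul_nonneg (hpos y ⟨by linarith [hz.1, hy.1], hy.2⟩).le ?_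
    have h1 : 0.7304 * (oddCoeff 6 * y ^ (3 * 6 + 2)) - evenCoeff 6 * y ^ (3 * 6 + 1)
        = (evenCoeff 6 - 0.7304 * oddCoeff 6 * y) * (-y * y ^ 18) := by ring
    rw [h1]
    have := hy.2
    refine mul_nonneg ?_ (mul_nonneg (by linarith) (by positivity))
    nlinarith [evenCoeff_pos 6, oddCoeff_pos 6]

lemma exists_largest_airy_zero : ∃ x₀, IsGreatest {x | airyDeriv 0 x = 0} x₀ ∧
    -2.3385 < x₀ ∧ x₀ < -2.3375 ∧ ∀ x, x₀ < x → 0 < airyDeriv 0 x := by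
  obtain ⟨z, hz, hz0⟩ := exists_airy_zero
  have hlt : ∀ x, airyDeriv 0 x = 0 → x < -2.3375 := fun x hx =>
    not_le.1 fun h => airy_ne_zero_of_ge h hx
  have hbdd : BddAbove {x | airyDeriv 0 x = 0} := ⟨-2.3375, fun x hx => (hlt x hx).le⟩
  have hmem : sSup {x | airyDeriv 0 x = 0} ∈ {x | airyDeriv 0 x = 0} :=
    isClosed_airy_zeros.csSup_mem ⟨z, hz0⟩ hbdd
  have hub : ∀ x, airyDeriv 0 x = 0 → x ≤ sSup {x | airyDeriv 0 x = 0} := fun x hx =>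
    le_csSup hbdd hx
  refine ⟨sSup {x | airyDeriv 0 x = 0}, ⟨hmem, hub⟩, hz.trans_le (hub z hz0), hlt _ hmem,
    fun x hx => ?_⟩
  exact airyDeriv_zero_pos_of_ne_zero (s := Set.Ioi (sSup {x | airyDeriv 0 x = 0}))
    Set.ordConnected_Ioi ((hlt _ hmem).trans (by norm_num))
    (fun y hy hy0 => absurd (hub y hy0) (not_le.2 hy)) hx

/-! ### Positivity of the recurrence coefficients -/

lemma antitoneOn_of_hasDerivAt_nonpos {f f' : ℝ → ℝ} {s : Set ℝ} (hs : Convex ℝ s)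
    (hf : ∀ x ∈ s, HasDerivAt f (f' x) x) (hf' : ∀ x ∈ s, f' x ≤ 0) : AntitoneOn f s :=
  antitoneOn_of_hasDerivWithinAt_nonpos hs
    (fun x hx => (hf x hx).continuousAt.continuousWithinAt)
    (fun x hx => (hf x (interior_subset hx)).hasDerivWithinAt)
    (fun x hx => hf' x (interior_subset hx))

lemma strictAntiOn_of_hasDerivAt_neg {f f' : ℝ → ℝ} {s : Set ℝ} (hs : Convex ℝ s)
    (hf : ∀ x ∈ s, HasDerivAt f (f' x) x) (hf' : ∀ x ∈ s, f' x < 0) : StrictAntiOn f s :=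
  strictAntiOn_of_hasDerivWithinAt_neg hs
    (fun x hx => (hf x hx).continuousAt.continuousWithinAt)
    (fun x hx => (hf x (interior_subset hx)).hasDerivWithinAt)
    (fun x hx => hf' x (interior_subset hx))

/-- A solution of `α' ≤ x - α²` whose derivative stays below `-κ < 0` would tend to
`-∞` in finite time, since `(1 / α)' ≥ 1 / 2` once `α² ≥ 2 x`. -/
lemma riccati_not_linear_decay {α α' : ℝ → ℝ} {a κ : ℝ} (hκ : 0 < κ)
    (hα : ∀ x, a ≤ x → HasDerivAt α (α' x) x) (hlin : ∀ x, a ≤ x → α' x ≤ -κ)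
    (hric : ∀ x, a ≤ x → α' x ≤ x - α x ^ 2) : False := by
  have hanti : AntitoneOn (fun x => α x + κ * x) (Set.Ici a) :=
    antitoneOn_of_hasDerivAt_nonpos (f' := fun x => α' x + κ) (convex_Ici a)
      (fun x hx => ((hα x hx).add ((hasDerivAt_id x).const_mul κ)).congr_deriv (by simp))
      (fun x hx => by have := hlin x hx; linarith)
  obtain ⟨c, hc⟩ := ((eventually_ge_atTop a).and ((eventually_ge_atTop (1 : ℝ)).and
    ((eventually_ge_atTop (2 * (α a + κ * a) / κ)).and (eventually_ge_atTop (8 / κ ^ 2))))).exists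
  obtain ⟨hca, hc1, hc2, hc3⟩ := hc
  have hlow : ∀ x, c ≤ x → α x ≤ -(κ / 2 * x) := by
    intro x hx
    have h1 := hanti Set.self_mem_Ici (hca.trans hx) (hca.trans hx)
    simp only at h1
    have h2 : 2 * (α a + κ * a) ≤ x * κ := (div_le_iff₀ hκ).1 (hc2.trans hx)
    linarith
  have hneg : ∀ x, c ≤ x → α x < 0 := by
    intro x hx
    have : 0 < κ / 2 * x := mul_pos (half_pos hκ) (by linarith)
    linarith [hlow x hx]
  have hsq : ∀ x, c ≤ x → 2 * x ≤ α x ^ 2 := by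
    intro x hx
    have h1 : (κ / 2 * x) ^ 2 ≤ α x ^ 2 := by
      have h0 : 0 ≤ κ / 2 * x := mul_nonneg (half_pos hκ).le (by linarith)
      nlinarith [hlow x hx]
    have h2 : 8 ≤ x * κ ^ 2 := (div_le_iff₀ (by positivity)).1 (hc3.trans hx)
    nlinarith
  have hmono : MonotoneOn (fun x => (α x)⁻¹ - x / 2) (Set.Ici c) := by
    refine monotoneOn_of_hasDerivAt_nonneg (f' := fun x => -α' x / α x ^ 2 - 1 / 2) (convex_Ici c)
      (fun x hx => ((hα x (hca.trans hx)).inv (hneg x hx).ne).sub ((hasDerivAt_id x).div_const 2))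
      (fun x hx => ?_)
    have h1 := hric x (hca.trans hx)
    have h2 := hsq x hx
    have h3 : 0 < α x ^ 2 := by have := (hneg x hx).ne; positivity
    rw [sub_nonneg, le_div_iff₀ h3]
    linarith
  have hv := inv_lt_zero.2 (hneg c le_rfl)
  have h1 := hmono (Set.self_mem_Ici) (show c ≤ c - 2 * (α c)⁻¹ by linarith) (by linarith)
  have h2 := inv_lt_zero.2 (hneg (c - 2 * (α c)⁻¹) (by linarith))
  simp only at h1
  linarith

/-- The mechanism that propagates positivity: if `c ≤ 0` somewhere, the product `b c` decreases
from there on and stays below a negative constant, so that `α' = c - b ≤ -κ < 0`,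
which the Riccati inequality `α' ≤ x - α²` forbids. -/
lemma pos_of_airy_system {b c α : ℝ → ℝ} {m a : ℝ} (hm : 0 ≤ m)
    (hb : ∀ x, a < x → 0 < b x)
    (hb' : ∀ x, a < x → HasDerivAt b (m - 2 * α x * b x) x)
    (hc' : ∀ x, a < x → HasDerivAt c (2 * α x * c x - (m + 1)) x)
    (hα' : ∀ x, a < x → HasDerivAt α (c x - b x) x)
    (hsum : ∀ x, a < x → c x = α x ^ 2 - x - b x) {x : ℝ} (hx : a < x) : 0 < c x := by
  by_contra hcx
  have hq' : ∀ y, a < y → HasDerivAt (fun y => b y * c y) (m * c y - (m + 1) * b y) y :=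
    fun y hy => ((hb' y hy).mul (hc' y hy)).congr_deriv (by ring)
  have hneg_of : ∀ y, a < y → c y ≤ 0 → m * c y - (m + 1) * b y < 0 := by
    intro y hy hcy
    have := hb y hy
    nlinarith [mul_nonneg hm (neg_nonneg.2 hcy), mul_nonneg hm this.le]
  have hc_of : ∀ y, a < y → b y * c y ≤ 0 → c y ≤ 0 := fun y hy h => by
    by_contra h'
    exact absurd h (not_le.2 (mul_pos (hb y hy) (not_le.1 h')))
  have hq0 : b x * c x ≤ 0 := mul_nonpos_of_nonneg_of_nonpos (hb x hx).le (not_lt.1 hcx)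
  have hc0 : ∀ y, x ≤ y → c y ≤ 0 := by
    intro y hy
    refine hc_of y (hx.trans_le hy) (le_trans ?_ hq0)
    exact image_le_of_deriv_right_lt_deriv_boundary (f := fun y => b y * c y)
      (f' := fun y => m * c y - (m + 1) * b y) (B := fun _ => b x * c x) (B' := fun _ => 0)
      (fun z hz => (hq' z (hx.trans_le hz.1)).continuousAt.continuousWithinAt)
      (fun z hz => (hq' z (hx.trans_le hz.1)).hasDerivWithinAt) le_rfl
      (fun z => hasDerivAt_const z _)
      (fun z hz hzq => hneg_of z (hx.trans_le hz.1)
        (hc_of z (hx.trans_le hz.1) (hzq.trans_le hq0))) ⟨hy, le_rfl⟩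
  have hanti : StrictAntiOn (fun y => b y * c y) (Set.Ici x) :=
    strictAntiOn_of_hasDerivAt_neg (convex_Ici x) (fun y hy => hq' y (hx.trans_le hy))
      (fun y hy => hneg_of y (hx.trans_le hy) (hc0 y hy))
  have hq1 : b (x + 1) * c (x + 1) < 0 :=
    (hanti Set.self_mem_Ici (show x ≤ x + 1 by linarith) (lt_add_one x)).trans_le hq0
  set κ := √(-(b (x + 1) * c (x + 1))) with hκ
  have hκ0 : 0 < κ := Real.sqrt_pos.2 (by linarith)
  have hκsq : κ ^ 2 = -(b (x + 1) * c (x + 1)) := Real.sq_sqrt (by linarith)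
  have hle : ∀ y, x + 1 ≤ y → x ≤ y ∧ a < y := fun y hy => ⟨by linarith, by linarith⟩
  refine riccati_not_linear_decay hκ0 (fun y hy => hα' y (hle y hy).2) (fun y hy => ?_)
    (fun y hy => ?_)
  · have h1 : b y * c y ≤ b (x + 1) * c (x + 1) :=
      hanti.antitoneOn (show x ≤ x + 1 by linarith) (hle y hy).1 hy
    have h2 := hb y (hle y hy).2
    have h3 := hc0 y (hle y hy).1
    -- `(b - c)² ≥ -4 b c ≥ κ²`
    have h4 : κ ≤ b y - c y := by
      refine le_of_sq_le_sq ?_ (by linarith)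
      nlinarith [sq_nonneg (b y + c y)]
    linarith
  · have h1 := hsum y (hle y hy).2
    have h2 := hc0 y (hle y hy).1
    linarith

/-- The recurrence coefficients of the orthogonal polynomials, in the real normalization in which
`p (n + 1) = (X + α n) p n + b n p (n - 1)` for the functional with moments `airyDeriv k x`: the
pair is `(b n, α n)`. The recursion solves the string equations
`b n + b (n + 1) = (α n)² - x` and `b n (α n + α (n - 1)) = n`. -/
def recPair (x : ℝ) : ℕ → ℝ × ℝ
  | 0 => (0, -(airyDeriv 1 x / airyDeriv 0 x))
  | n + 1 => ((recPair x n).2 ^ 2 - x - (recPair x n).1,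
      (n + 1) / ((recPair x n).2 ^ 2 - x - (recPair x n).1) - (recPair x n).2)

/-- The off-diagonal recurrence coefficient, up to sign. -/
def recB (n : ℕ) (x : ℝ) : ℝ := (recPair x n).1

/-- The diagonal recurrence coefficient, up to sign. -/
def recA (n : ℕ) (x : ℝ) : ℝ := (recPair x n).2

lemma recB_succ (n : ℕ) (x : ℝ) : recB (n + 1) x = recA n x ^ 2 - x - recB n x := rfl

lemma recA_succ (n : ℕ) (x : ℝ) : recA (n + 1) x = (n + 1) / recB (n + 1) x - recA n x := rfl

lemma hasDerivAt_recB_succ {n : ℕ} {x : ℝ}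
    (hα : HasDerivAt (recA n) (recB (n + 1) x - recB n x) x)
    (hb : HasDerivAt (recB n) (n - 2 * recA n x * recB n x) x) :
    HasDerivAt (recB (n + 1)) (2 * recA n x * recB (n + 1) x - (n + 1)) x :=
  (((hα.pow 2).sub (hasDerivAt_id x)).sub hb).congr_deriv (by simp; ring)

/-- The Toda equations for the recurrence coefficients. -/
lemma hasDerivAt_rec (n : ℕ) {x : ℝ} (hx : airyDeriv 0 x ≠ 0)
    (hb : ∀ k < n, recB (k + 1) x ≠ 0) :
    HasDerivAt (recA n) (recB (n + 1) x - recB n x) x ∧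
      HasDerivAt (recB n) (n - 2 * recA n x * recB n x) x := by
  induction n with
  | zero =>
    constructor
    · refine ((hasDerivAt_airyDeriv_one x).div (hasDerivAt_airyDeriv 0 x) hx).neg.congr_deriv ?_
      rw [recB_succ]
      simp only [recB, recA, recPair]
      field_simp
      ring
    · refine (hasDerivAt_const x (0 : ℝ)).congr_deriv ?_
      simp [recB, recPair]
  | succ n ih =>
    obtain ⟨hα, hbn⟩ := ih fun k hk => hb k (hk.trans (Nat.lt_succ_self n))
    have hb1 := hasDerivAt_recB_succ hα hbn
    have hne := hb n (Nat.lt_succ_self n)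
    constructor
    · refine (((hasDerivAt_const x ((n : ℝ) + 1)).div hb1 hne).sub hα).congr_deriv ?_
      rw [recB_succ (n + 1), recA_succ]
      have h := recB_succ n x
      generalize recB (n + 1) x = B at *
      field_simp
      linear_combination B ^ 2 * h
    · refine hb1.congr_deriv ?_
      rw [recA_succ]
      push_cast
      field_simp
      ring

/-- The function `Ai'² - x Ai²` has derivative `-Ai²` and tends to `0` at `+∞`. -/
lemma airy_energy_pos {x₀ x : ℝ} (hpos : ∀ x, x₀ < x → 0 < airyDeriv 0 x) (hx : x₀ < x) :
    0 < airyDeriv 1 x ^ 2 - x * airyDeriv 0 x ^ 2 := by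
  have hanti : StrictAntiOn (fun x => airyDeriv 1 x ^ 2 - x * airyDeriv 0 x ^ 2) (Set.Ici x) := by
    refine strictAntiOn_of_hasDerivAt_neg (f' := fun y => -airyDeriv 0 y ^ 2) (convex_Ici x)
      (fun y _ => ?_) (fun y hy => ?_)
    · refine (((hasDerivAt_airyDeriv_one y).pow 2).sub
        ((hasDerivAt_id y).mul ((hasDerivAt_airyDeriv 0 y).pow 2))).congr_deriv ?_
      simp
      ring
    · have := hpos y (hx.trans_le hy)
      simp only [Left.neg_neg_iff]
      positivity
  have h1 := hanti Set.self_mem_Ici (show x ≤ x + 1 by linarith) (lt_add_one x)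
  refine lt_of_le_of_lt ?_ h1
  refine le_of_tendsto tendsto_airy_energy ?_
  filter_upwards [eventually_ge_atTop (x + 1)] with y hy
  exact hanti.antitoneOn (show x ≤ x + 1 by linarith) (show x ≤ y by linarith) hy

lemma recB_succ_pos {x₀ : ℝ} (hpos : ∀ x, x₀ < x → 0 < airyDeriv 0 x) (n : ℕ) :
    ∀ x, x₀ < x → 0 < recB (n + 1) x := by
  induction n using Nat.strong_induction_on with
  | _ n ih =>
    have hd : ∀ x, x₀ < x → _ := fun x hx =>
      hasDerivAt_rec n (hpos x hx).ne' fun k hk => (ih k hk x hx).ne'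
    cases n with
    | zero =>
      intro x hx
      have h1 := airy_energy_pos hpos hx
      have h2 := hpos x hx
      have : recB (0 + 1) x
          = (airyDeriv 1 x ^ 2 - x * airyDeriv 0 x ^ 2) / airyDeriv 0 x ^ 2 := by
        rw [recB_succ]
        simp only [recB, recA, recPair]
        field_simp
        ring
      rw [this]
      positivity
    | succ n =>
      intro x hx
      exact pos_of_airy_system (Nat.cast_nonneg (n + 1)) (ih n (Nat.lt_succ_self n))
        (fun y hy => (hd y hy).2)
        (fun y hy => hasDerivAt_recB_succ (hd y hy).1 (hd y hy).2) (fun y hy => (hd y hy).1)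
        (fun y _ => recB_succ _ _) hx

/-! ### Orthogonal polynomials from the recurrence -/

open Polynomial in
/-- The linear functional on polynomials with moments `μ k`. -/
def momentFunctional {K : Type*} [Field K] (μ : ℕ → K) : K[X] →ₗ[K] K :=
  Polynomial.lsum fun k => LinearMap.mulRight K (μ k)

open Polynomial in
lemma momentFunctional_monomial {K : Type*} [Field K] (μ : ℕ → K) (k : ℕ) (c : K) :
    momentFunctional μ (monomial k c) = c * μ k := by
  simp [momentFunctional, Polynomial.lsum_apply, Polynomial.sum_monomial_index]

open Polynomial in
/-- The polynomials with `p (n + 1) = (X + a n) p n + b n p (n - 1)`; at `n = 0` the truncated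
subtraction is harmless because `b 0 = 0` is assumed wherever they are used. -/
def recPoly {K : Type*} [Field K] (a b : ℕ → K) : ℕ → K[X]
  | 0 => 1
  | 1 => (X + C (a 0)) * 1 + C (b 0) * 1
  | n + 2 => (X + C (a (n + 1))) * recPoly a b (n + 1) + C (b (n + 1)) * recPoly a b n

section Orthogonality

open Polynomial

variable {K : Type*} [Field K] {a b : ℕ → K}

lemma recPoly_succ (a b : ℕ → K) (n : ℕ) :
    recPoly a b (n + 1) = (X + C (a n)) * recPoly a b n + C (b n) * recPoly a b (n - 1) := by
  cases n <;> simp [recPoly]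

lemma recPoly_monic_natDegree (hb0 : b 0 = 0) (n : ℕ) :
    (recPoly a b n).Monic ∧ (recPoly a b n).natDegree = n := by
  induction n using Nat.strong_induction_on with
  | _ n ih =>
    match n with
    | 0 => exact ⟨monic_one, natDegree_one⟩
    | 1 =>
      simp only [recPoly, hb0, mul_one, map_zero, add_zero]
      exact ⟨monic_X_add_C _, natDegree_X_add_C _⟩
    | n + 2 =>
      obtain ⟨h1, h2⟩ := ih (n + 1) (by omega)
      obtain ⟨h3, h4⟩ := ih n (by omega)
      have hm : ((X + C (a (n + 1))) * recPoly a b (n + 1)).Monic := (monic_X_add_C _).mul h1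
      have hd : ((X + C (a (n + 1))) * recPoly a b (n + 1)).natDegree = n + 2 := by
        rw [(monic_X_add_C _).natDegree_mul h1, natDegree_X_add_C, h2]; omega
      have hlt : (C (b (n + 1)) * recPoly a b n).natDegree < n + 2 := by
        refine lt_of_le_of_lt (natDegree_C_mul_le _ _) ?_
        omega
      have hdeg : (C (b (n + 1)) * recPoly a b n).degree
          < ((X + C (a (n + 1))) * recPoly a b (n + 1)).degree :=
        degree_lt_degree (hd ▸ hlt)
      refine ⟨hm.add_of_left hdeg, ?_⟩
      rw [recPoly, natDegree_add_eq_left_of_natDegree_lt (hd ▸ hlt), hd]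

/-- Subtracting the right multiple of a monic polynomial removes the leading term. -/
lemma degree_sub_C_mul_lt {p q : K[X]} {m : ℕ} (hp : p.Monic) (hd : p.natDegree = m)
    (hq : q.degree < ((m + 1 : ℕ) : WithBot ℕ)) : (q - C (q.coeff m) * p).degree < m := by
  rw [degree_lt_iff_coeff_zero] at hq ⊢
  intro k hk
  rcases hk.eq_or_lt with rfl | hk
  · have : p.coeff m = 1 := hd ▸ hp.coeff_natDegree
    simp [this]
  · have hz : p.coeff k = 0 := coeff_eq_zero_of_natDegree_lt (by omega)
    rw [coeff_sub, coeff_C_mul, hq k hk, hz, mul_zero, sub_zero]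

/-- Pairing with an orthogonal polynomial of degree `m` reads off the coefficient of degree `m`. -/
lemma map_mul_of_orthogonal {L : K[X] →ₗ[K] K} {p : K[X]} {m : ℕ} (hp : p.Monic)
    (hd : p.natDegree = m) (ho : ∀ q : K[X], q.degree < m → L (p * q) = 0) {q : K[X]}
    (hq : q.degree < (m + 1 : ℕ)) : L (p * q) = q.coeff m * L (p * p) := by
  have hr := degree_sub_C_mul_lt hp hd hq
  have h := ho _ hr
  have hsplit : p * (q - C (q.coeff m) * p) = p * q - q.coeff m • (p * p) := by
    rw [smul_eq_C_mul]; ring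
  rw [hsplit, map_sub, map_smul, smul_eq_mul, sub_eq_zero] at h
  exact h

lemma degree_X_mul_lt {q : K[X]} {m : ℕ} (hq : q.degree < m) :
    (X * q).degree < ((m + 1 : ℕ) : WithBot ℕ) := by
  rw [degree_lt_iff_coeff_zero] at hq ⊢
  intro k hk
  obtain ⟨k, rfl⟩ : ∃ j, k = j + 1 := ⟨k - 1, by omega⟩
  rw [coeff_X_mul]
  exact hq k (by omega)

/-- If a functional satisfies the string equation `L (p') + x L p = L (X² p)` and the scalars
`a`, `b` satisfy the corresponding discrete Painlevé recursion, then the polynomials generated by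
the three-term recurrence are orthogonal for `L`. -/
lemma recPoly_orthogonal {L : K[X] →ₗ[K] K} {x : K} (hb0 : b 0 = 0)
    (hL : ∀ p, L (derivative p) + x * L p = L (X ^ 2 * p))
    (h1 : L X = -a 0 * L 1)
    (hb : ∀ n, b (n + 1) = a n ^ 2 - x - b n)
    (ha : ∀ n, b (n + 1) * (a (n + 1) + a n) = n + 1) (n : ℕ) :
    (∀ q : K[X], q.degree < n → L (recPoly a b n * q) = 0) ∧
    (∀ q : K[X], q.degree < (n + 1 : ℕ) → L (recPoly a b (n + 1) * q) = 0) ∧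
    L (recPoly a b (n + 1) * recPoly a b (n + 1))
      = -b (n + 1) * L (recPoly a b n * recPoly a b n) ∧
    L (X * recPoly a b n * recPoly a b n) = -a n * L (recPoly a b n * recPoly a b n) := by
  induction n with
  | zero =>
    have hX2 : L (X ^ 2) = x * L 1 := by simpa using (hL 1).symm
    have hp1 : recPoly a b (0 + 1) = X + C (a 0) := by simp [recPoly, hb0]
    have hp0 : recPoly a b 0 = 1 := rfl
    refine ⟨fun q hq => ?_, fun q hq => ?_, ?_, ?_⟩
    · have : q = 0 := by simpa [degree_eq_bot, Nat.WithBot.lt_zero_iff] using hq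
      simp [this]
    · have hq0 : q = C (q.coeff 0) := by
        ext k
        cases k with
        | zero => simp
        | succ k => rw [(degree_lt_iff_coeff_zero q 1).1 hq (k + 1) (by omega), coeff_C_succ]
      rw [hq0, hp1]
      have : (X + C (a 0)) * C (q.coeff 0) = q.coeff 0 • X + (q.coeff 0 * a 0) • (1 : K[X]) := by
        rw [smul_eq_C_mul, smul_eq_C_mul, map_mul]; ring
      rw [this, map_add, map_smul, map_smul, h1, smul_eq_mul, smul_eq_mul]
      ring
    · rw [hp1, hp0]
      have : (X + C (a 0)) * (X + C (a 0))
          = X ^ 2 + (2 * a 0) • X + (a 0 ^ 2) • (1 : K[X]) := by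
        rw [smul_eq_C_mul, smul_eq_C_mul, map_mul, map_pow, map_ofNat]; ring
      rw [this, map_add, map_add, map_smul, map_smul, h1, hX2, smul_eq_mul, smul_eq_mul, hb, hb0,
        mul_one]
      ring
    · simp [hp0, h1]
  | succ n ih =>
    obtain ⟨ho, ho1, hh, -⟩ := ih
    obtain ⟨hm, hd⟩ := recPoly_monic_natDegree (a := a) hb0 n
    obtain ⟨hm1, hd1⟩ := recPoly_monic_natDegree (a := a) hb0 (n + 1)
    obtain ⟨hm2, hd2⟩ := recPoly_monic_natDegree (a := a) hb0 (n + 2)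
    have hrec := recPoly_succ a b n
    have hrec1 : recPoly a b (n + 2) = (X + C (a (n + 1))) * recPoly a b (n + 1)
      + C (b (n + 1)) * recPoly a b n := rfl
    have hprev : b n ≠ 0 → (recPoly a b (n - 1)).degree < n := by
      intro hbn
      obtain ⟨m, rfl⟩ : ∃ m, n = m + 1 := ⟨n - 1, by
        have : n ≠ 0 := by rintro rfl; exact hbn hb0
        omega⟩
      obtain ⟨hm', hd'⟩ := recPoly_monic_natDegree (a := a) hb0 m
      rw [Nat.add_sub_cancel, degree_eq_natDegree hm'.ne_zero, hd']
      exact_mod_cast Nat.lt_succ_self m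
    set P := recPoly a b n with hP
    set Q := recPoly a b (n + 1) with hQ
    set R := recPoly a b (n + 2) with hR
    set Z := recPoly a b (n - 1) with hZ
    have degP : P.degree < (n + 1 : ℕ) := by
      rw [degree_eq_natDegree hm.ne_zero, hd]; exact_mod_cast Nat.lt_succ_self n
    have degQ : Q.degree < (n + 2 : ℕ) := by
      rw [degree_eq_natDegree hm1.ne_zero, hd1]; exact_mod_cast Nat.lt_succ_self (n + 1)
    have coeffP : P.coeff n = 1 := hd ▸ hm.coeff_natDegree
    have coeffQ : Q.coeff (n + 1) = 1 := hd1 ▸ hm1.coeff_natDegree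
    have hQP : L (Q * P) = 0 := ho1 P degP
    have hQXP : L (Q * (X * P)) = L (Q * Q) := by
      rw [map_mul_of_orthogonal hm1 hd1 ho1 (degree_X_mul_lt degP), coeff_X_mul, coeffP, one_mul]
    have hQXZ : b n * L (Q * (X * Z)) = 0 := by
      by_cases hbn : b n = 0
      · rw [hbn, zero_mul]
      · rw [ho1 _ (degree_X_mul_lt (hprev hbn)), mul_zero]
    have hdP : (derivative P).degree < (n + 1 : ℕ) :=
      lt_of_le_of_lt (degree_derivative_le) degP
    have hdQ : (derivative Q).degree < (n + 1 : ℕ) := by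
      have := degree_derivative_lt hm1.ne_zero
      rwa [degree_eq_natDegree hm1.ne_zero, hd1] at this
    have hXQQ : L (X * Q * Q) = -a (n + 1) * L (Q * Q) := by
      have hs := hL (Q * P)
      have e1 : L (derivative (Q * P)) = (n + 1) * L (P * P) := by
        rw [derivative_mul, map_add, mul_comm (derivative Q), ho1 _ hdP,
          map_mul_of_orthogonal hm hd ho hdQ, coeff_derivative, coeffQ]
        ring
      have e2 : X ^ 2 * (Q * P) = X * Q * Q - a n • (Q * (X * P)) - b n • (Q * (X * Z)) := by
        rw [smul_eq_C_mul, smul_eq_C_mul]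
        linear_combination (-(X * Q)) * hrec
      rw [e1, hQP, e2, map_sub, map_sub, map_smul, map_smul, smul_eq_mul, smul_eq_mul, hQXZ,
        hQXP] at hs
      have := ha n
      linear_combination -hs + (a (n + 1) + a n) * hh - L (P * P) * this
    have ho2 : ∀ q : K[X], q.degree < (n + 1 + 1 : ℕ) → L (R * q) = 0 := by
      intro q hq
      have hr := degree_sub_C_mul_lt hm1 hd1 hq
      set r := q - C (q.coeff (n + 1)) * Q with hrdef
      have e1 : L (R * Q) = 0 := by
        have : R * Q = X * Q * Q + a (n + 1) • (Q * Q) + b (n + 1) • (Q * P) := by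
          rw [hrec1, smul_eq_C_mul, smul_eq_C_mul]; ring
        rw [this, map_add, map_add, map_smul, map_smul, hQP, hXQQ, smul_eq_mul, smul_eq_mul]
        ring
      have e2 : L (R * r) = 0 := by
        have : R * r = Q * (X * r) + a (n + 1) • (Q * r) + b (n + 1) • (P * r) := by
          rw [hrec1, smul_eq_C_mul, smul_eq_C_mul]; ring
        rw [this, map_add, map_add, map_smul, map_smul, ho1 r hr,
          map_mul_of_orthogonal hm1 hd1 ho1 (degree_X_mul_lt hr),
          map_mul_of_orthogonal hm hd ho hr, coeff_X_mul, hh, smul_eq_mul, smul_eq_mul]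
        ring
      have : R * q = R * r + q.coeff (n + 1) • (R * Q) := by
        rw [hrdef, smul_eq_C_mul]; ring
      rw [this, map_add, map_smul, e1, e2, smul_zero, add_zero]
    refine ⟨ho1, ho2, ?_, hXQQ⟩
    have hRXQ : L (R * (X * Q)) = L (R * R) := by
      rw [map_mul_of_orthogonal hm2 hd2 ho2 (degree_X_mul_lt degQ), coeff_X_mul, coeffQ, one_mul]
    have hs := hL (Q * Q)
    have e1 : L (derivative (Q * Q)) = 0 := by
      rw [derivative_mul, map_add, mul_comm (derivative Q), ho1 _ hdQ, add_zero]
    have e2 : X ^ 2 * (Q * Q)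
        = R * (X * Q) - a (n + 1) • (X * Q * Q) - b (n + 1) • (Q * (X * P)) := by
      rw [hrec1, smul_eq_C_mul, smul_eq_C_mul]; ring
    rw [e1, e2, map_sub, map_sub, map_smul, map_smul, smul_eq_mul, smul_eq_mul, hXQQ, hQXP,
      hRXQ] at hs
    have := hb (n + 1)
    linear_combination -hs + L (Q * Q) * this

end Orthogonality

/-! ### Hankel determinants -/

section Hankel

open Polynomial

variable {K : Type*} [Field K]

/-- The polynomial of degree less than `n` with coefficient vector `v`. -/
def polyOfVec {n : ℕ} (v : Fin n → K) : K[X] := ∑ j : Fin n, monomial (j : ℕ) (v j)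

lemma coeff_polyOfVec {n : ℕ} (v : Fin n → K) (j : Fin n) : (polyOfVec v).coeff j = v j := by
  rw [polyOfVec, finsetSum_coeff, Finset.sum_eq_single j]
  · simp
  · intro i _ hij
    rw [coeff_monomial, if_neg (fun h => hij (Fin.ext h))]
  · simp

lemma degree_polyOfVec_lt {n : ℕ} (v : Fin n → K) : (polyOfVec v).degree < n := by
  rw [degree_lt_iff_coeff_zero]
  intro k hk
  rw [polyOfVec, finsetSum_coeff]
  refine Finset.sum_eq_zero fun j _ => ?_
  rw [coeff_monomial, if_neg (by have := j.2; omega)]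

lemma polyOfVec_coeff {n : ℕ} {q : K[X]} (hq : q.degree < n) :
    polyOfVec (fun j : Fin n => q.coeff j) = q := by
  ext k
  by_cases hk : k < n
  · exact coeff_polyOfVec _ ⟨k, hk⟩
  · rw [(degree_lt_iff_coeff_zero _ _).1 (degree_polyOfVec_lt _) k (not_lt.1 hk),
      (degree_lt_iff_coeff_zero _ _).1 hq k (not_lt.1 hk)]

/-- The Hankel matrix of a moment sequence. -/
def hankelMatrix (μ : ℕ → K) (n : ℕ) : Matrix (Fin n) (Fin n) K :=
  Matrix.of fun j k => μ ((j : ℕ) + (k : ℕ))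

lemma momentFunctional_polyOfVec_mul_X_pow (μ : ℕ → K) {n : ℕ} (v : Fin n → K) (k : Fin n) :
    momentFunctional μ (polyOfVec v * X ^ (k : ℕ)) = (hankelMatrix μ n).mulVec v k := by
  rw [polyOfVec, Finset.sum_mul, map_sum, Matrix.mulVec, dotProduct]
  refine Finset.sum_congr rfl fun j _ => ?_
  rw [monomial_mul_X_pow, momentFunctional_monomial, hankelMatrix, Matrix.of_apply, mul_comm,
    add_comm]

lemma det_hankelMatrix_ne_zero_iff (μ : ℕ → K) (n : ℕ) :
    (hankelMatrix μ n).det ≠ 0 ↔ ∀ q : K[X], q.degree < n →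
      (∀ k < n, momentFunctional μ (q * X ^ k) = 0) → q = 0 := by
  rw [Ne, ← Matrix.exists_mulVec_eq_zero_iff]
  constructor
  · intro h q hq hk
    by_contra hq0
    refine h ⟨fun j => q.coeff j, fun hv => hq0 ?_, ?_⟩
    · rw [← polyOfVec_coeff hq, hv]
      simp [polyOfVec]
    · ext k
      rw [← momentFunctional_polyOfVec_mul_X_pow, polyOfVec_coeff hq, hk k k.2, Pi.zero_apply]
  · rintro h ⟨v, hv, hv0⟩
    refine hv ?_
    have := h (polyOfVec v) (degree_polyOfVec_lt v) fun k hk => by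
      rw [momentFunctional_polyOfVec_mul_X_pow μ v ⟨k, hk⟩, hv0, Pi.zero_apply]
    ext j
    rw [← coeff_polyOfVec v j, this, coeff_zero, Pi.zero_apply]

lemma existsUnique_monic_of_det_ne_zero {μ : ℕ → K} {n : ℕ} (h : (hankelMatrix μ n).det ≠ 0) :
    ∃! p : K[X], p.Monic ∧ p.natDegree = n ∧
      ∀ k < n, momentFunctional μ (p * X ^ k) = 0 := by
  have hu : IsUnit (hankelMatrix μ n).det := isUnit_iff_ne_zero.2 h
  set v : Fin n → K := (hankelMatrix μ n)⁻¹.mulVec fun k => -μ (n + k) with hv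
  have hlt := degree_polyOfVec_lt v
  refine ⟨X ^ n + polyOfVec v, ⟨monic_X_pow_add hlt, ?_, fun k hk => ?_⟩, ?_⟩
  · rw [natDegree_add_eq_left_of_degree_lt (by rwa [degree_X_pow]), natDegree_X_pow]
  · rw [add_mul, map_add, momentFunctional_polyOfVec_mul_X_pow μ v ⟨k, hk⟩, hv,
      Matrix.mulVec_mulVec, Matrix.mul_nonsing_inv _ hu, Matrix.one_mulVec, ← pow_add,
      ← monomial_one_right_eq_X_pow, momentFunctional_monomial]
    simp
  · rintro p ⟨hp, hd, ho⟩
    rw [← sub_eq_zero]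
    refine (det_hankelMatrix_ne_zero_iff μ n).1 h _ ?_ fun k hk => ?_
    · have h1 : (p - X ^ n).degree < (n : WithBot ℕ) := by
        have := degree_sub_lt_left (p := p) (q := X ^ n) ?_ hp.ne_zero ?_
        · rwa [degree_eq_natDegree hp.ne_zero, hd] at this
        · rw [degree_X_pow, degree_eq_natDegree hp.ne_zero, hd]
        · rw [hp.leadingCoeff, (monic_X_pow n).leadingCoeff]
      rw [← sub_sub]
      exact (degree_sub_le _ _).trans_lt (max_lt h1 hlt)
    · rw [sub_mul, map_sub, ho k hk, add_mul, map_add,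
        momentFunctional_polyOfVec_mul_X_pow μ v ⟨k, hk⟩, hv,
        Matrix.mulVec_mulVec, Matrix.mul_nonsing_inv _ hu, Matrix.one_mulVec, ← pow_add,
        ← monomial_one_right_eq_X_pow, momentFunctional_monomial]
      simp

/-- Orthogonal polynomials with nonzero norms force the Hankel determinants to be nonzero: a
kernel vector is a polynomial `q`, of degree `m` say, and pairing it with the orthogonal
polynomial of degree `m` gives its leading coefficient times a norm. -/
lemma det_hankelMatrix_ne_zero {μ : ℕ → K} {p : ℕ → K[X]} (hp : ∀ m, (p m).Monic)
    (hd : ∀ m, (p m).natDegree = m)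
    (ho : ∀ m : ℕ, ∀ q : K[X], q.degree < m → momentFunctional μ (p m * q) = 0)
    (hn : ∀ m, momentFunctional μ (p m * p m) ≠ 0) (n : ℕ) : (hankelMatrix μ n).det ≠ 0 := by
  rw [det_hankelMatrix_ne_zero_iff]
  intro q hq hk
  by_contra hq0
  have hqn : q.natDegree < n := (natDegree_lt_iff_degree_lt hq0).2 hq
  have h1 : momentFunctional μ (p q.natDegree * q) = 0 := by
    rw [(p q.natDegree).as_sum_range' n (by rw [hd]; exact hqn), Finset.sum_mul, map_sum]
    refine Finset.sum_eq_zero fun i hi => ?_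
    rw [← C_mul_X_pow_eq_monomial, mul_assoc, ← smul_eq_C_mul, map_smul, mul_comm,
      hk i (Finset.mem_range.1 hi), smul_zero]
  rw [map_mul_of_orthogonal (hp _) (hd _) (ho _) (by
    rw [degree_eq_natDegree hq0]; exact_mod_cast Nat.lt_succ_self _)] at h1
  exact mul_ne_zero (leadingCoeff_ne_zero.2 hq0) (hn _) h1

end Hankel

/-! ### Application to the Airy moments -/

/-- The string equation `L (p') + x L p = L (X² p)` for the functional with the derivatives of the
Airy function as moments. -/
lemma airy_string (x : ℝ) (p : Polynomial ℝ) :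
    momentFunctional (fun k => airyDeriv k x) (Polynomial.derivative p)
      + x * momentFunctional (fun k => airyDeriv k x) p
      = momentFunctional (fun k => airyDeriv k x) (Polynomial.X ^ 2 * p) := by
  induction p using Polynomial.induction_on' with
  | add p q hp hq =>
    rw [Polynomial.derivative_add, mul_add, map_add, map_add, map_add, ← hp, ← hq]
    ring
  | monomial k c =>
    rw [Polynomial.derivative_monomial, mul_comm (Polynomial.X ^ 2), Polynomial.monomial_mul_X_pow,
      momentFunctional_monomial, momentFunctional_monomial, momentFunctional_monomial]
    cases k with
    | zero => rw [airyDeriv_two]; simp; ring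
    | succ k =>
      rw [show k + 1 + 2 = k + 3 by ring, airyDeriv_three_term, Nat.add_sub_cancel]
      push_cast
      ring

lemma det_hankel_airy_ne_zero {x₀ : ℝ} (hpos : ∀ x, x₀ < x → 0 < airyDeriv 0 x) {x : ℝ}
    (hx : x₀ < x) (n : ℕ) : (hankelMatrix (fun k => airyDeriv k x) n).det ≠ 0 := by
  have hA := (hpos x hx).ne'
  have hbpos : ∀ n, 0 < recB (n + 1) x := fun n => recB_succ_pos hpos n x hx
  have hb0 : (fun n => recB n x) 0 = 0 := rfl
  have hL1 : momentFunctional (fun k => airyDeriv k x) 1 = airyDeriv 0 x := by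
    rw [← Polynomial.monomial_zero_one, momentFunctional_monomial, one_mul]
  have horth := recPoly_orthogonal (a := fun n => recA n x) (b := fun n => recB n x) hb0
    (airy_string x) (by
      rw [hL1, ← Polynomial.monomial_one_one_eq_X, momentFunctional_monomial]
      simp only [recA, recPair]
      field_simp)
    (fun n => recB_succ n x) (fun n => by
      have := (hbpos n).ne'
      simp only [recA_succ]
      field_simp
      ring)
  refine det_hankelMatrix_ne_zero (fun m => (recPoly_monic_natDegree hb0 m).1)
    (fun m => (recPoly_monic_natDegree hb0 m).2) (fun m => (horth m).1) (fun m => ?_) n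
  induction m with
  | zero =>
    rw [recPoly, one_mul, hL1]
    exact hA
  | succ m ih =>
    rw [(horth m).2.2.1]
    exact mul_ne_zero (neg_ne_zero.2 (hbpos m).ne') ih

/-- The complex Hankel matrix is a diagonal rescaling of the real one. -/
lemma det_hankel_ne_zero {γ : ℝ → ℂ} (hγ : IsContour (5 * Real.pi / 6) (Real.pi / 6) γ) {δ : ℝ}
    {n : ℕ} (h : (hankelMatrix (fun k => airyDeriv k (-δ)) n).det ≠ 0) :
    (hankel γ δ n).det ≠ 0 := by
  have hfac : hankel γ δ n = (2 * Real.pi : ℂ) •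
      (Matrix.diagonal (fun j : Fin n => (-Complex.I) ^ (j : ℕ))
        * (hankelMatrix (fun k => airyDeriv k (-δ)) n).map (algebraMap ℝ ℂ)
        * Matrix.diagonal (fun j : Fin n => (-Complex.I) ^ (j : ℕ))) := by
    ext j k
    rw [Matrix.smul_apply, Matrix.mul_diagonal, Matrix.diagonal_mul, Matrix.map_apply, hankel,
      Matrix.of_apply, moment_eq hγ, hankelMatrix, Matrix.of_apply, smul_eq_mul, pow_add]
    simp only [Complex.coe_algebraMap]
    ring
  have hI : ∀ j : ℕ, (-Complex.I) ^ j ≠ 0 := fun j =>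
    pow_ne_zero _ (neg_ne_zero.2 Complex.I_ne_zero)
  have hpi : (2 * Real.pi : ℂ) ≠ 0 :=
    mul_ne_zero two_ne_zero (by exact_mod_cast Real.pi_ne_zero)
  have hmap : ((hankelMatrix (fun k => airyDeriv k (-δ)) n).map (algebraMap ℝ ℂ)).det ≠ 0 := by
    rw [← RingHom.mapMatrix_apply, ← RingHom.map_det]
    exact (map_ne_zero _).2 h
  rw [hfac, Matrix.det_smul, Matrix.det_mul, Matrix.det_mul, Matrix.det_diagonal]
  exact mul_ne_zero (pow_ne_zero _ hpi) (mul_ne_zero (mul_ne_zero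
    (Finset.prod_ne_zero_iff.2 fun j _ => hI j) hmap) (Finset.prod_ne_zero_iff.2 fun j _ => hI j))

lemma hasContourIntegral_polynomial {γ : ℝ → ℂ}
    (hγ : IsContour (5 * Real.pi / 6) (Real.pi / 6) γ) (δ : ℝ) (p : Polynomial ℂ) (k : ℕ) :
    HasContourIntegral γ (fun z => p.eval z * z ^ k * weight δ z)
      (momentFunctional (moment γ δ) (p * Polynomial.X ^ k)) := by
  have hmom : ∀ k, HasContourIntegral γ (fun z => z ^ k * weight δ z) (moment γ δ k) := fun k =>
    moment_eq hγ δ k ▸ hasContourIntegral_moment hγ δ k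
  have hval : momentFunctional (moment γ δ) (p * Polynomial.X ^ k)
      = ∑ i ∈ Finset.range (p.natDegree + 1), p.coeff i * moment γ δ (i + k) := by
    conv_lhs => rw [p.as_sum_range, Finset.sum_mul, map_sum]
    refine Finset.sum_congr rfl fun i _ => ?_
    rw [Polynomial.monomial_mul_X_pow, momentFunctional_monomial]
  rw [hval]
  refine (tendsto_finsetSum _ fun i _ => (hmom (i + k)).const_mul (p.coeff i)).congr fun q => ?_
  simp only [partialIntegral]
  simp only [← intervalIntegral.integral_const_mul]
  rw [← intervalIntegral.integral_finsetSum]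
  · refine intervalIntegral.integral_congr fun t _ => ?_
    rw [Polynomial.eval_eq_sum_range, Finset.sum_mul, Finset.sum_mul, Finset.sum_mul]
    refine Finset.sum_congr rfl fun i _ => ?_
    ring
  · intro i _
    refine IntervalIntegrable.const_mul ?_ _
    exact (hγ.deriv_integrable _ _).continuousOn_mul
      ((differentiable_pow_mul_weight δ (i + k)).continuous.comp hγ.continuous).continuousOn

lemma HasContourIntegral.unique {γ : ℝ → ℂ} {f : ℂ → ℂ} {v w : ℂ}
    (h : HasContourIntegral γ f v) (h' : HasContourIntegral γ f w) : v = w :=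
  tendsto_nhds_unique h h'

lemma isMonicOrthogonal_iff {γ : ℝ → ℂ} (hγ : IsContour (5 * Real.pi / 6) (Real.pi / 6) γ)
    (δ : ℝ) (n : ℕ) (p : Polynomial ℂ) :
    IsMonicOrthogonal γ δ n p ↔ p.Monic ∧ p.natDegree = n ∧
      ∀ k < n, momentFunctional (moment γ δ) (p * Polynomial.X ^ k) = 0 := by
  constructor
  · rintro ⟨h1, h2, h3⟩
    exact ⟨h1, h2, fun k hk => (hasContourIntegral_polynomial hγ δ p k).unique (h3 k hk)⟩
  · rintro ⟨h1, h2, h3⟩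
    exact ⟨h1, h2, fun k hk => h3 k hk ▸ hasContourIntegral_polynomial hγ δ p k⟩

end AiryOP

end

theorem theorem2 :
    ∃ δ₀ : ℝ, IsLeast {δ : ℝ | AiryOP.Ai (-(δ : ℂ)) = 0} δ₀ ∧
      |δ₀ - 2.338| < 0.0005 ∧
      ∀ γ : ℝ → ℂ, AiryOP.IsContour (5 * Real.pi / 6) (Real.pi / 6) γ →
        ∀ (n : ℕ) (δ : ℝ), δ < δ₀ →
          (∀ k : ℕ, AiryOP.HasContourIntegral γ (fun z => z ^ k * AiryOP.weight δ z)
            (AiryOP.moment γ δ k)) ∧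
          (AiryOP.hankel γ δ n).det ≠ 0 ∧
          ∃! p : Polynomial ℂ, AiryOP.IsMonicOrthogonal γ δ n p := by
  obtain ⟨x₀, hgreatest, hlow, hup, hpos⟩ := AiryOP.exists_largest_airy_zero
  have hAi : ∀ δ : ℝ, AiryOP.Ai (-(δ : ℂ)) = 0 ↔ AiryOP.airyDeriv 0 (-δ) = 0 := by
    intro δ
    rw [← Complex.ofReal_neg, AiryOP.Ai_ofReal, Complex.ofReal_eq_zero]
  refine ⟨-x₀, ⟨?_, fun δ hδ => ?_⟩, ?_, fun γ hγ n δ hδ => ?_⟩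
  · rw [Set.mem_ofPred_eq, hAi, neg_neg]
    exact hgreatest.1
  · have := hgreatest.2 ((hAi δ).1 hδ)
    linarith
  · rw [abs_lt]
    constructor <;> linarith
  · have hdet := AiryOP.det_hankel_ne_zero hγ
      (AiryOP.det_hankel_airy_ne_zero hpos (show x₀ < -δ by linarith) n)
    refine ⟨fun k => AiryOP.moment_eq hγ δ k ▸ AiryOP.hasContourIntegral_moment hγ δ k, hdet, ?_⟩
    simp only [AiryOP.isMonicOrthogonal_iff hγ]
    exact AiryOP.existsUnique_monic_of_det_ne_zero hdet
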